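/- **Theorem 2.** Consider the half-line problem $U_t=V$, $V_t=U_{xx}$ on $[0,\infty)\times[0,T]$ with the Dirichlet condition $U(0,t)=f(t)$, and the grid $x_j=jh$, $j=0,1,2,\dots$, with $0<h\le 1$. Let $e_1=[1,0,0,\dots]^T$, $d_1=\frac1h[-\frac{11}{6},3,-\frac32,\frac13,0,\dots]^T$, $H=h\,\mathrm{diag}(\frac{17}{48},\frac{59}{48},\frac{43}{48},\frac{49}{48},1,1,\dots)$, and let $A$ be the symmetric positive semidefinite matrix with $$hA=\begin{bmatrix}\frac98&-\frac{59}{48}&\frac1{12}&\frac1{48}\\-\frac{59}{48}&\frac{59}{24}&-\frac{59}{48}&0\\\frac1{12}&-\frac{59}{48}&\frac{55}{24}&-\frac{59}{48}&\frac1{12}\\\frac1{48}&0&-\frac{59}{48}&\frac{59}{24}&-\frac43&\frac1{12}\\&&\frac1{12}&-\frac43&\frac52&-\frac43&\frac1{12}\\&&&\ddots&\ddots&\ddots&\ddots&\ddots\end{bmatrix},$$ so that $D=H^{-1}(-A-e_1d_1^T)$ is the $(4,2)$ diagonal-norm summation-by-parts operator of Mattsson and Nordström for $d^2/dx^2$.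 The energy-based semidiscretization is $$A(u_t-v)=d_1(e_1^Tv-f_t),\qquad v_t=Du+\beta H^{-1}e_1(e_1^Tv-f_t),$$ for differentiable $u,v:[0,T]\to\ell^2$, with $u(0)$ and $v(0)$ equal to $U(\cdot,0)$ and $V(\cdot,0)$ on the grid. Put $\|w\|_h^2=h\sum_j w_j^2$. Let $r=4$ if $\beta<0$ (dissipative scheme) and $r=3$ if $\beta=0$ (energy-conserving scheme). Then the scheme converges with rate $r$ in $L^2$: there is an integer $N$ depending only on $\beta$ and, for every $T>0$, a constant $K$ depending only on $\beta$ and $T$, such that the following holds for every $0<h\le1$, every $M\ge0$, and every solution $(U,V)$ that is $C^\infty$ on $[0,\infty)\times[0,T]$ and satisfies $\|\partial_x^kU(\cdot,t)\|_{L^2(0,\infty)}\le M$ and $\|\partial_x^kV(\cdot,t)\|_{L^2(0,\infty)}\le M$ for $0\le k\le N$ and $0\le t\le T$. The scheme has a solution, and every solution $(u,v)$ of the scheme satisfies $$\|u(t)-U(\cdot,t)\|_h\le K\,h^{r}\,M\qquad\text{for all }t\in[0,T].$$ -/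

import Mathlib

open MeasureTheory Set
open scoped ContDiff

noncomputable section

/-- Square summable grid functions on the half-line grid `x_j = j * h`, `j = 0, 1, 2, …`. -/
abbrev GridFun : Type := lp (fun _ : ℕ => ℝ) 2

/-- The diagonal of the norm matrix `H` (quadrature weights). -/
def sbpH (h : ℝ) : ℕ → ℝ
  | 0 => h * (17 / 48)
  | 1 => h * (59 / 48)
  | 2 => h * (43 / 48)
  | 3 => h * (49 / 48)
  | _ + 4 => h

/-- The first canonical grid function `e₁` (the boundary point `x = 0` has index `0`). -/
def sbpE1 : ℕ → ℝ
  | 0 => 1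
  | _ + 1 => 0

/-- The boundary derivative stencil `d₁`, with `d₁ᵀ u ≈ u_x(0)`. -/
def sbpD1 (h : ℝ) : ℕ → ℝ
  | 0 => (-11 / 6) / h
  | 1 => 3 / h
  | 2 => (-3 / 2) / h
  | 3 => (1 / 3) / h
  | _ + 4 => 0

/-- `d₁ᵀ u`. -/
def sbpD1Apply (h : ℝ) (u : ℕ → ℝ) : ℝ :=
  ∑ j ∈ Finset.range 4, sbpD1 h j * u j

/-- The action of the symmetric positive semidefinite matrix `A` of the fourth order
diagonal-norm SBP second derivative operator of Mattsson and Nordström on the half line. -/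
def sbpA (h : ℝ) (u : ℕ → ℝ) : ℕ → ℝ
  | 0 => (9 / 8 * u 0 - 59 / 48 * u 1 + 1 / 12 * u 2 + 1 / 48 * u 3) / h
  | 1 => (-59 / 48 * u 0 + 59 / 24 * u 1 - 59 / 48 * u 2) / h
  | 2 => (1 / 12 * u 0 - 59 / 48 * u 1 + 55 / 24 * u 2 - 59 / 48 * u 3 + 1 / 12 * u 4) / h
  | 3 => (1 / 48 * u 0 - 59 / 48 * u 2 + 59 / 24 * u 3 - 4 / 3 * u 4 + 1 / 12 * u 5) / h
  | j + 4 => (1 / 12 * u (j + 2) - 4 / 3 * u (j + 3) + 5 / 2 * u (j + 4)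
      - 4 / 3 * u (j + 5) + 1 / 12 * u (j + 6)) / h

/-- The SBP operator `D = H⁻¹ (-A - e₁ d₁ᵀ) ≈ d²/dx²`. Its boundary rows, multiplied by `h²`, are
`(2, -5, 4, -1)`, `(1, -2, 1)`, `(-4, 59, -110, 59, -4) / 43` and
`(-1, 0, 59, -118, 64, -4) / 49`. -/
def sbpD (h : ℝ) (u : ℕ → ℝ) (j : ℕ) : ℝ :=
  (sbpH h j)⁻¹ * (-sbpA h u j - sbpE1 j * sbpD1Apply h u)

/-- `(U, V)` is a smooth solution of `U_t = V`, `V_t = U_xx` on `[0, ∞) × [0, T]` with the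
Dirichlet condition `U(0, t) = f(t)`. Derivatives are one-sided at the boundary. -/
structure IsSmoothWaveSolution (T : ℝ) (f : ℝ → ℝ) (U V : ℝ → ℝ → ℝ) : Prop where
  smooth_U : ContDiffOn ℝ ∞ (fun p : ℝ × ℝ => U p.1 p.2) (Ici 0 ×ˢ Icc 0 T)
  smooth_V : ContDiffOn ℝ ∞ (fun p : ℝ × ℝ => V p.1 p.2) (Ici 0 ×ˢ Icc 0 T)
  eq_U : ∀ x ∈ Ici (0 : ℝ), ∀ t ∈ Icc 0 T,
    HasDerivWithinAt (fun τ => U x τ) (V x t) (Icc 0 T) t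
  eq_V : ∀ x ∈ Ici (0 : ℝ), ∀ t ∈ Icc 0 T,
    HasDerivWithinAt (fun τ => V x τ)
      (iteratedDerivWithin 2 (fun y => U y t) (Ici 0) x) (Icc 0 T) t
  dirichlet : ∀ t ∈ Icc 0 T, U 0 t = f t

/-- For all times in `[0, T]`, the `x`-derivatives of `W(·, t)` of order at most `N` have
`L²(0, ∞)` norm at most `M`. -/
def SobolevBound (N : ℕ) (T M : ℝ) (W : ℝ → ℝ → ℝ) : Prop :=
  ∀ t ∈ Icc 0 T, ∀ k ≤ N,
    eLpNorm (fun x => iteratedDerivWithin k (fun y => W y t) (Ici 0) x) 2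
      (volume.restrict (Ici 0)) ≤ ENNReal.ofReal M

/-- `(u, v)` solves, on `[0, T]`, the energy-based semidiscretization
`A (u_t - v) = d₁ (e₁ᵀ v - f_t)`, `v_t = D u + β H⁻¹ e₁ (e₁ᵀ v - f_t)`
with the initial data `U(·, 0)`, `V(·, 0)` restricted to the grid. -/
structure IsSchemeSolution (h β T : ℝ) (f : ℝ → ℝ) (U V : ℝ → ℝ → ℝ)
    (u v : ℝ → GridFun) : Prop where
  init_u : ∀ j : ℕ, u 0 j = U (j * h) 0
  init_v : ∀ j : ℕ, v 0 j = V (j * h) 0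
  evolution : ∀ t ∈ Icc 0 T, ∃ ut vt : GridFun,
    HasDerivWithinAt u ut (Icc 0 T) t ∧ HasDerivWithinAt v vt (Icc 0 T) t ∧
    (∀ j : ℕ, sbpA h (fun i => ut i - v t i) j
      = sbpD1 h j * (v t 0 - derivWithin f (Icc 0 T) t)) ∧
    (∀ j : ℕ, vt j = sbpD h (fun i => u t i) j
      + β * (sbpH h j)⁻¹ * sbpE1 j * (v t 0 - derivWithin f (Icc 0 T) t))

/-- The scheme with dissipation parameter `β` is solvable and converges with rate `r` in `L²`:
`‖u(t) - U(·, t)‖_h ≤ K h^r M` on `[0, T]`, where `‖w‖_h² = h ∑ w_j²`, where `M` bounds the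
derivatives of `U` and `V` of order at most `N`, where `N` depends only on `β`, and where `K`
depends only on `β` and `T`. -/
def ConvergesWithRate (β : ℝ) (r : ℕ) : Prop :=
  ∃ N : ℕ, ∀ T : ℝ, 0 < T → ∃ K : ℝ, ∀ M : ℝ, 0 ≤ M →
    ∀ (f : ℝ → ℝ) (U V : ℝ → ℝ → ℝ), IsSmoothWaveSolution T f U V →
    SobolevBound N T M U → SobolevBound N T M V →
    ∀ h : ℝ, 0 < h → h ≤ 1 →
      (∃ u v : ℝ → GridFun, IsSchemeSolution h β T f U V u v) ∧
      ∀ u v : ℝ → GridFun, IsSchemeSolution h β T f U V u v →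
        ∀ t ∈ Icc 0 T,
          Summable (fun j : ℕ => (u t j - U (j * h) t) ^ 2) ∧
          Real.sqrt (h * ∑' j : ℕ, (u t j - U (j * h) t) ^ 2) ≤ K * h ^ r * M

end

noncomputable section

open Filter Topology

/-! ### The boundary operators on square summable grid functions -/

/-! `A` is injective on `ℓ²` and `gridG`, written g below, solves A g = d₁. The scheme is therefore
the linear evolution equation u_t = v + (v₀ - f_t) g, v_t = D u + b (v₀ - f_t) e₁ with b = 48 β /
(17 h), where the subscript 0 denotes the boundary value. Operators are taken at grid size one, so D
there carries a factor h⁻². The errors e = u - U and ε = v - V satisfy the same system with zero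
data and the truncation error τ as forcing. Away from four boundary rows τ is O(h⁴) in the discrete
norm; in those rows it is only O(h²), which the energy estimate `energy_estimate` alone would turn
into a loss of order.

Two devices recover the loss. First, the system is integrated in time: x = ∫ e and y = ∫ ε solve it
with forcing σ = ∫ τ, and e = x_t = y + y₀ g, so the velocity part of the energy of (x, y) already
controls e. Secondly, the four boundary values of σ are absorbed by an explicit corrector of size
h². Up to a multiple of e₁, each boundary unit vector, and g itself, lies in the range of D on `ℓ²`
(`exists_layer`); subtracting a slowly decaying lift (`exists_lift`) makes these layers vanish at
the boundary point.

What remains is a scalar balance at the boundary. The corrector has two free amplitudes: p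
multiplies the layer belonging to g, and a multiplies g in the velocity. The multiple a g does not
affect y + y₀ g, because g₀ = -1. The remaining force is (s - αg p - b a) e₁ + (p - a') g, with s a
fixed combination of the boundary values of σ. For β = 0 it vanishes for p = s / αg and a = ∫ p,
where αg ≠ 0 by `exists_gridG_layer`. For β < 0, b is of size 1/h, and two terms of the expansion in
1/b suffice. `exists_corrected_estimate` is the stability bound for given amplitudes and
`exists_forcing_estimate` chooses them.

Both cases yield rate four. The rate three claimed for β = 0 is deduced from it by h ≤ 1. -/

/-- The continuous linear operator on `ℓ²` given by a linear map on sequences with continuous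
coordinates that preserves `ℓ²`. -/
def gridOp (F : (ℕ → ℝ) →ₗ[ℝ] (ℕ → ℝ)) (hF : ∀ u : GridFun, Memℓp (F u) 2)
    (hc : ∀ j, Continuous fun u : ℕ → ℝ => F u j) : GridFun →L[ℝ] GridFun :=
  ContinuousLinearMap.ofSeqClosedGraph
    (g := { toFun := fun u => (⟨F u, hF u⟩ : GridFun)
            map_add' := fun u v => Subtype.ext (F.map_add _ _)
            map_smul' := fun c u => Subtype.ext (F.map_smul _ _) })
    (by
      intro u x y hu hy
      -- The graph is closed because `ℓ²` convergence implies coordinatewise convergence, and the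
      -- coordinates of F are continuous.
      have hcoe : Continuous fun w : GridFun => (w : ℕ → ℝ) :=
        lp.uniformContinuous_coe.continuous
      apply lp.ext
      funext j
      have h1 := ((hc j).comp hcoe).tendsto x |>.comp hu
      have h2 := ((continuous_apply j).comp hcoe).tendsto y |>.comp hy
      exact tendsto_nhds_unique h2 h1)

lemma memlp_two_iff (f : ℕ → ℝ) : Memℓp f 2 ↔ Summable fun j => f j ^ 2 := by
  rw [memℓp_gen_iff (by norm_num)]
  simp

lemma gridFun_summable_sq (u : GridFun) : Summable fun j => u j ^ 2 :=
  (memlp_two_iff _).1 (lp.memℓp u)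

lemma gridFun_norm_sq (u : GridFun) : ‖u‖ ^ 2 = ∑' j, u j ^ 2 := by
  have := lp.norm_rpow_eq_tsum (p := 2) (by norm_num) u
  simpa using this

lemma Memℓp.congr_fun {f f' : ℕ → ℝ} (hf : Memℓp f 2) (h : ∀ j, f' j = f j) : Memℓp f' 2 := by
  rwa [funext h]

lemma memlp_shift {f : ℕ → ℝ} (hf : Memℓp f 2) (k : ℕ) : Memℓp (fun j => f (j + k)) 2 := by
  rw [memlp_two_iff] at hf ⊢
  exact (summable_nat_add_iff (f := fun j => f j ^ 2) k).2 hf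

lemma memlp_of_shift {f : ℕ → ℝ} (k : ℕ) (hf : Memℓp (fun j => f (j + k)) 2) : Memℓp f 2 := by
  rw [memlp_two_iff] at hf ⊢
  exact (summable_nat_add_iff (f := fun j => f j ^ 2) k).1 hf

lemma gridFun_tendsto_zero (u : GridFun) : Tendsto (fun j => u j) atTop (𝓝 0) := by
  have h := (gridFun_summable_sq u).tendsto_atTop_zero
  have h2 := h.sqrt
  simp only [Real.sqrt_sq_eq_abs, Real.sqrt_zero] at h2
  exact (tendsto_zero_iff_abs_tendsto_zero _).2 h2

lemma gridFun_hasSum_inner (x y : GridFun) : HasSum (fun j => x j * y j) (inner ℝ x y) := by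
  have := lp.hasSum_inner (𝕜 := ℝ) x y
  simpa [mul_comm] using this

lemma gridFun_abs_apply_le (u : GridFun) (j : ℕ) : |u j| ≤ ‖u‖ := by
  simpa using lp.norm_apply_le_norm (p := 2) (by norm_num) u j

lemma sbpA_add (h : ℝ) (u v : ℕ → ℝ) : sbpA h (u + v) = sbpA h u + sbpA h v := by
  funext j
  rcases j with _ | _ | _ | _ | j <;> simp only [sbpA, Pi.add_apply] <;> ring

lemma sbpA_smul (h c : ℝ) (u : ℕ → ℝ) : sbpA h (c • u) = c • sbpA h u := by
  funext j
  rcases j with _ | _ | _ | _ | j <;> simp only [sbpA, Pi.smul_apply, smul_eq_mul] <;> ring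

/-- `sbpA` as a linear map on sequences. -/
def sbpALin (h : ℝ) : (ℕ → ℝ) →ₗ[ℝ] (ℕ → ℝ) where
  toFun := sbpA h
  map_add' := sbpA_add h
  map_smul' := sbpA_smul h

lemma sbpD1Apply_eq (h : ℝ) (u : ℕ → ℝ) :
    sbpD1Apply h u = (-11 / 6 * u 0 + 3 * u 1 - 3 / 2 * u 2 + 1 / 3 * u 3) / h := by
  simp only [sbpD1Apply, Finset.sum_range_succ, Finset.sum_range_zero, sbpD1]
  ring

/-- `sbpD` as a linear map on sequences. -/
def sbpDLin (h : ℝ) : (ℕ → ℝ) →ₗ[ℝ] (ℕ → ℝ) where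
  toFun := sbpD h
  map_add' u v := by
    funext j
    simp only [sbpD, sbpA_add, sbpD1Apply_eq, Pi.add_apply]
    ring
  map_smul' c u := by
    funext j
    simp only [sbpD, sbpA_smul, sbpD1Apply_eq, Pi.smul_apply, smul_eq_mul, RingHom.id_apply]
    ring

/-- The norm matrix as a linear map on sequences. -/
def sbpHLin (h : ℝ) : (ℕ → ℝ) →ₗ[ℝ] (ℕ → ℝ) where
  toFun u j := sbpH h j * u j
  map_add' u v := funext fun j => mul_add (sbpH h j) (u j) (v j)
  map_smul' c u := funext fun j => mul_left_comm (sbpH h j) c (u j)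

lemma memlp_sbpA (h : ℝ) (u : GridFun) : Memℓp (sbpA h u) 2 := by
  apply memlp_of_shift 4
  have hs := fun k => memlp_shift (lp.memℓp u) k
  have := ((((((hs 2).const_mul (1 / 12 / h)).add ((hs 3).const_mul (-(4 / 3) / h))).add
    ((hs 4).const_mul (5 / 2 / h))).add ((hs 5).const_mul (-(4 / 3) / h))).add
    ((hs 6).const_mul (1 / 12 / h)))
  refine this.congr_fun fun j => ?_
  simp only [sbpA, Pi.add_apply]
  ring

lemma memlp_sbpH (h : ℝ) (u : GridFun) : Memℓp (fun j => sbpH h j * u j) 2 := by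
  apply memlp_of_shift 4
  exact (memlp_shift (lp.memℓp u) 4).const_mul h

lemma memlp_sbpD (h : ℝ) (u : GridFun) : Memℓp (sbpD h u) 2 := by
  apply memlp_of_shift 4
  refine ((memlp_shift (memlp_sbpA h u) 4).const_mul (-h⁻¹)).congr_fun fun j => ?_
  simp only [sbpD, sbpH, sbpE1]
  ring

lemma continuous_sbpA (h : ℝ) (j : ℕ) : Continuous fun u : ℕ → ℝ => sbpA h u j := by
  rcases j with _ | _ | _ | _ | j <;> simp only [sbpA] <;> fun_prop

/-- The stiffness operator `A` on `ℓ²`. -/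
def opA (h : ℝ) : GridFun →L[ℝ] GridFun :=
  gridOp (sbpALin h) (memlp_sbpA h) (continuous_sbpA h)

/-- The second derivative operator `D` on `ℓ²`. -/
def opD (h : ℝ) : GridFun →L[ℝ] GridFun :=
  gridOp (sbpDLin h) (memlp_sbpD h) (fun j => by
    have := continuous_sbpA h j
    simp only [sbpDLin, LinearMap.coe_mk, AddHom.coe_mk, sbpD, sbpD1Apply_eq]
    fun_prop)

/-- The norm operator `H` on `ℓ²`. -/
def opH (h : ℝ) : GridFun →L[ℝ] GridFun :=
  gridOp (sbpHLin h) (memlp_sbpH h) (fun j => by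
    simp only [sbpHLin, LinearMap.coe_mk, AddHom.coe_mk]
    fun_prop)

lemma opA_apply (h : ℝ) (u : GridFun) (j : ℕ) : opA h u j = sbpA h u j := rfl
lemma opH_apply (h : ℝ) (u : GridFun) (j : ℕ) : opH h u j = sbpH h j * u j := rfl

/-- `d₁` at grid size one as an element of `ℓ²`. -/
def gridD1 : GridFun := ⟨sbpD1 1, memlp_of_shift 4 (by simpa [sbpD1] using zero_mem_ℓp')⟩

/-- `e₁` as an element of `ℓ²`. -/
def gridE1 : GridFun := ⟨sbpE1, memlp_of_shift 1 (by simpa [sbpE1] using zero_mem_ℓp')⟩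

lemma gridD1_apply (j : ℕ) : gridD1 j = sbpD1 1 j := rfl
lemma gridE1_apply (j : ℕ) : gridE1 j = sbpE1 j := rfl

lemma inner_gridE1 (x : GridFun) : inner ℝ gridE1 x = x 0 := by
  refine (gridFun_hasSum_inner gridE1 x).unique ?_
  have : HasSum (fun j => gridE1 j * x j) (∑ j ∈ Finset.range 1, gridE1 j * x j) :=
    hasSum_sum_of_ne_finset_zero (by
      intro j hj
      rcases j with _ | j
      · simp at hj
      · simp [gridE1_apply, sbpE1])
  simpa [gridE1_apply, sbpE1] using this

lemma inner_gridD1 (x : GridFun) : inner ℝ gridD1 x = sbpD1Apply 1 x := by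
  refine (gridFun_hasSum_inner gridD1 x).unique ?_
  have : HasSum (fun j => gridD1 j * x j) (∑ j ∈ Finset.range 4, gridD1 j * x j) :=
    hasSum_sum_of_ne_finset_zero (by
      intro j hj
      rcases j with _ | _ | _ | _ | j <;> simp at hj
      simp [gridD1_apply, sbpD1])
  exact this

/-! ### Summation by parts -/

/-- The symmetric bilinear form of `A` at grid size one, up to the grid point `N + 3`. -/
def sbpForm (x y : ℕ → ℝ) (N : ℕ) : ℝ :=
  1 / 48 * (59 * (x 1 - x 0) * (y 1 - y 0) + 59 * (x 2 - x 1) * (y 2 - y 1)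
    + 51 * (x 3 - x 2) * (y 3 - y 2) - 4 * (x 2 - x 0) * (y 2 - y 0) - (x 3 - x 0) * (y 3 - y 0))
  + ∑ i ∈ Finset.range N, ((x (i + 4) - x (i + 3)) * (y (i + 4) - y (i + 3))
    + 1 / 12 * (x (i + 2) - 2 * x (i + 3) + x (i + 4)) * (y (i + 2) - 2 * y (i + 3) + y (i + 4)))

/-- The boundary term at the far end in the summation by parts formula. -/
def sbpFar (x y : ℕ → ℝ) (N : ℕ) : ℝ :=
  x (N + 3) * (y (N + 3) - y (N + 4))
  + 1 / 12 * (x (N + 2) - 2 * x (N + 3)) * (y (N + 2) - 2 * y (N + 3) + y (N + 4))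
  + 1 / 12 * x (N + 3) * (y (N + 3) - 2 * y (N + 4) + y (N + 5))

/-- The first four rows fix the boundary coefficients of the form; each further row is a discrete
product rule that moves the far term one point outwards. -/
lemma sum_mul_sbpA (x y : ℕ → ℝ) (N : ℕ) :
    ∑ j ∈ Finset.range (N + 4), x j * sbpA 1 y j = sbpForm x y N + sbpFar x y N := by
  induction N with
  | zero =>
    simp only [Finset.sum_range_succ, Finset.sum_range_zero, sbpA, sbpForm, sbpFar]
    ring
  | succ n ih =>
    rw [show n + 1 + 4 = (n + 4) + 1 by ring, Finset.sum_range_succ, ih]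
    simp only [sbpForm, sbpFar, Finset.sum_range_succ, sbpA]
    ring_nf

lemma sbpForm_comm (x y : ℕ → ℝ) (N : ℕ) : sbpForm x y N = sbpForm y x N := by
  simp only [sbpForm]
  congr 1
  · ring
  · exact Finset.sum_congr rfl fun i _ => by ring

/-- Square summable sequences tend to zero, so the far boundary term disappears in the limit. -/
lemma sbpForm_tendsto (x y : GridFun) :
    Tendsto (sbpForm x y) atTop (𝓝 (inner ℝ x (opA 1 y))) := by
  have h1 := (gridFun_hasSum_inner x (opA 1 y)).tendsto_sum_nat.comp (tendsto_add_atTop_nat 4)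
  have hx := fun k => (gridFun_tendsto_zero x).comp (tendsto_add_atTop_nat k)
  have hy := fun k => (gridFun_tendsto_zero y).comp (tendsto_add_atTop_nat k)
  have h2 : Tendsto (sbpFar x y) atTop (𝓝 0) := by
    have := (((hx 3).mul ((hy 3).sub (hy 4))).add
      ((((hx 2).sub ((hx 3).const_mul 2)).const_mul (1 / 12)).mul
        (((hy 2).sub ((hy 3).const_mul 2)).add (hy 4)))).add
      (((hx 3).const_mul (1 / 12)).mul (((hy 3).sub ((hy 4).const_mul 2)).add (hy 5)))
    rw [show (0 : ℝ) * (0 - 0) + 1 / 12 * (0 - 2 * 0) * (0 - 2 * 0 + 0)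
      + 1 / 12 * 0 * (0 - 2 * 0 + 0) = 0 by norm_num] at this
    exact this
  have h3 := h1.sub h2
  rw [sub_zero] at h3
  refine h3.congr fun N => ?_
  have := sum_mul_sbpA x y N
  simp only [Function.comp_apply, opA_apply]
  linarith

lemma inner_opA_comm (x y : GridFun) : inner ℝ x (opA 1 y) = inner ℝ (opA 1 x) y := by
  rw [real_inner_comm y (opA 1 x)]
  refine tendsto_nhds_unique (sbpForm_tendsto x y) ?_
  exact (sbpForm_tendsto y x).congr fun N => sbpForm_comm _ _ _

lemma sbpForm_lower (x : ℕ → ℝ) (N : ℕ) :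
    1 / 2 * ((x 1 - x 0) ^ 2 + (x 2 - x 1) ^ 2 + (x 3 - x 2) ^ 2)
      + ∑ i ∈ Finset.range N, (x (i + 4) - x (i + 3)) ^ 2 ≤ sbpForm x x N := by
  unfold sbpForm
  refine add_le_add ?_ (Finset.sum_le_sum fun i _ => ?_)
  -- The two negative squares are absorbed: (x₂-x₀)² is at most twice, and (x₃-x₀)² at most three
  -- times, the sum of the squared increments involved. This even leaves 48/48 of each increment.
  · nlinarith [sq_nonneg (x 1 - x 0 - (x 2 - x 1)), sq_nonneg (x 1 - x 0 - (x 3 - x 2)),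
      sq_nonneg (x 2 - x 1 - (x 3 - x 2)), sq_nonneg (x 1 - x 0), sq_nonneg (x 2 - x 1),
      sq_nonneg (x 3 - x 2)]
  · nlinarith [sq_nonneg (x (i + 2) - 2 * x (i + 3) + x (i + 4))]

lemma inner_opA_nonneg (x : GridFun) : 0 ≤ inner ℝ x (opA 1 x) :=
  ge_of_tendsto' (sbpForm_tendsto x x) fun N =>
    le_trans (by positivity) (sbpForm_lower x N)

lemma sbpForm_monotone (x : ℕ → ℝ) : Monotone (sbpForm x x) := by
  refine monotone_nat_of_le_succ fun N => ?_
  simp only [sbpForm, Finset.sum_range_succ]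
  nlinarith [sq_nonneg (x (N + 2) - 2 * x (N + 3) + x (N + 4)), sq_nonneg (x (N + 4) - x (N + 3))]

/-- The partial forms increase to ⟨x, Ax⟩ = 0, hence all increments of x vanish, and a constant in
`ℓ²` is zero. -/
lemma opA_injective : Function.Injective (opA 1) := by
  rw [injective_iff_map_eq_zero]
  intro x hx
  have h0 : inner ℝ x (opA 1 x) = 0 := by rw [hx, inner_zero_right]
  have hle : ∀ N, sbpForm x x N ≤ 0 := fun N => by
    rw [← h0]
    exact (sbpForm_monotone x).ge_of_tendsto (sbpForm_tendsto x x) N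
  have hstep : ∀ j, x (j + 1) = x j := by
    intro j
    have h1 := (sbpForm_lower x (j + 1)).trans (hle (j + 1))
    have h2 : 0 ≤ ∑ i ∈ Finset.range (j + 1), (x (i + 4) - x (i + 3)) ^ 2 := by positivity
    have h3 : ∀ {a : ℝ}, a ^ 2 ≤ 0 → a = 0 := fun ha =>
      (pow_eq_zero_iff two_ne_zero).1 (le_antisymm ha (sq_nonneg _))
    rcases j with _ | _ | _ | j
    · have : x 1 - x 0 = 0 := h3 (by
        nlinarith [sq_nonneg (x 1 - x 0), sq_nonneg (x 2 - x 1), sq_nonneg (x 3 - x 2)])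
      linarith
    · have : x 2 - x 1 = 0 := h3 (by
        nlinarith [sq_nonneg (x 1 - x 0), sq_nonneg (x 2 - x 1), sq_nonneg (x 3 - x 2)])
      linarith
    · have : x 3 - x 2 = 0 := h3 (by
        nlinarith [sq_nonneg (x 1 - x 0), sq_nonneg (x 2 - x 1), sq_nonneg (x 3 - x 2)])
      linarith
    · have h4 := Finset.single_le_sum (f := fun i => (x (i + 4) - x (i + 3)) ^ 2)
        (fun i _ => sq_nonneg _) (Finset.mem_range.2 (show j < j + 3 + 1 by omega))
      have : x (j + 4) - x (j + 3) = 0 := h3 (by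
        nlinarith [sq_nonneg (x 1 - x 0), sq_nonneg (x 2 - x 1), sq_nonneg (x 3 - x 2)])
      linarith
  have hc : ∀ j, x j = x 0 := fun j => by
    induction j with
    | zero => rfl
    | succ n ih => rw [hstep, ih]
  have hz : x 0 = 0 := by
    refine tendsto_nhds_unique ?_ (gridFun_tendsto_zero x)
    simp only [hc]
    exact tendsto_const_nhds
  apply lp.ext
  funext j
  rw [hc j, hz]
  rfl

lemma sbpH_one_pos (j : ℕ) : 0 < sbpH 1 j := by
  rcases j with _ | _ | _ | _ | j <;> simp only [sbpH] <;> norm_num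

lemma sbpH_one_le (j : ℕ) : sbpH 1 j ≤ 2 := by
  rcases j with _ | _ | _ | _ | j <;> simp only [sbpH] <;> norm_num

lemma sbpH_one_ge (j : ℕ) : 1 / 3 ≤ sbpH 1 j := by
  rcases j with _ | _ | _ | _ | j <;> simp only [sbpH] <;> norm_num

lemma inner_opH_comm (x y : GridFun) : inner ℝ x (opH 1 y) = inner ℝ (opH 1 x) y := by
  refine (gridFun_hasSum_inner x (opH 1 y)).unique ?_
  refine (gridFun_hasSum_inner (opH 1 x) y).congr_fun fun j => ?_
  simp only [opH_apply]
  ring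

lemma inner_opH_le (x : GridFun) : inner ℝ (opH 1 x) x ≤ 2 * ‖x‖ ^ 2 := by
  rw [← real_inner_self_eq_norm_sq]
  refine hasSum_le (fun j => ?_) (gridFun_hasSum_inner (opH 1 x) x)
    ((gridFun_hasSum_inner x x).mul_left 2)
  simp only [opH_apply]
  nlinarith [mul_nonneg (sub_nonneg.2 (sbpH_one_le j)) (mul_self_nonneg (x j))]

lemma inner_opH_ge (x : GridFun) : 1 / 3 * ‖x‖ ^ 2 ≤ inner ℝ (opH 1 x) x := by
  rw [← real_inner_self_eq_norm_sq]
  refine hasSum_le (fun j => ?_) ((gridFun_hasSum_inner x x).mul_left (1 / 3))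
    (gridFun_hasSum_inner (opH 1 x) x)
  simp only [opH_apply]
  nlinarith [mul_nonneg (sub_nonneg.2 (sbpH_one_ge j)) (mul_self_nonneg (x j))]

lemma norm_opH_le (x : GridFun) : ‖opH 1 x‖ ≤ 2 * ‖x‖ := by
  refine le_of_sq_le_sq ?_ (by positivity)
  rw [mul_pow, ← real_inner_self_eq_norm_sq, ← real_inner_self_eq_norm_sq]
  refine hasSum_le (fun j => ?_) (gridFun_hasSum_inner (opH 1 x) (opH 1 x))
    ((gridFun_hasSum_inner x x).mul_left (2 ^ 2))
  simp only [opH_apply]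
  have h1 := sbpH_one_le j
  have h2 := sbpH_one_pos j
  have : sbpH 1 j ^ 2 ≤ 2 ^ 2 := by gcongr
  nlinarith [mul_nonneg (sub_nonneg.2 this) (mul_self_nonneg (x j))]

lemma opH_opD (x : GridFun) :
    opH 1 (opD 1 x) = -opA 1 x - sbpD1Apply 1 x • gridE1 := by
  apply lp.ext
  funext j
  have := (sbpH_one_pos j).ne'
  change sbpH 1 j * sbpD 1 x j = -sbpA 1 x j - sbpD1Apply 1 x * sbpE1 j
  rw [sbpD]
  field_simp

/-- The summation by parts identity: the boundary term has exactly the form that the term in g of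
the u equation cancels in the energy balance. -/
lemma inner_opH_opD (y x : GridFun) :
    inner ℝ (opH 1 y) (opD 1 x) = -inner ℝ y (opA 1 x) - y 0 * inner ℝ gridD1 x := by
  rw [← inner_opH_comm, opH_opD, inner_sub_right, inner_neg_right, inner_smul_right,
    real_inner_comm gridE1 y, inner_gridE1, inner_gridD1]
  ring

/-! ### Scaling of the operators with the grid size. -/

lemma sbpA_eq_div (h : ℝ) (u : ℕ → ℝ) (j : ℕ) : sbpA h u j = sbpA 1 u j / h := by
  rcases j with _ | _ | _ | _ | j <;> simp only [sbpA, div_one]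

lemma sbpD1_eq_div (h : ℝ) (j : ℕ) : sbpD1 h j = sbpD1 1 j / h := by
  rcases j with _ | _ | _ | _ | j <;> simp only [sbpD1, div_one, zero_div]

lemma sbpH_eq_mul (h : ℝ) (j : ℕ) : sbpH h j = h * sbpH 1 j := by
  rcases j with _ | _ | _ | _ | j <;> simp only [sbpH, one_mul, mul_one]

lemma sbpD_eq_div (h : ℝ) (u : ℕ → ℝ) (j : ℕ) : sbpD h u j = sbpD 1 u j / h ^ 2 := by
  simp only [sbpD, sbpA_eq_div h, sbpD1Apply_eq h, sbpD1Apply_eq 1, sbpH_eq_mul h, mul_inv]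
  ring

/-! ### Boundary layers of the difference operator -/

/-- The root in `(0, 1)` of the characteristic polynomial of the interior stencil. -/
def stencilRoot : ℝ := 7 - 4 * Real.sqrt 3

lemma stencilRoot_sq : stencilRoot ^ 2 = 14 * stencilRoot - 1 := by
  have := Real.sq_sqrt (show (0 : ℝ) ≤ 3 by norm_num)
  unfold stencilRoot
  linear_combination 16 * this

lemma stencilRoot_pos : 0 < stencilRoot := by
  have : Real.sqrt 3 < 7 / 4 := (Real.sqrt_lt' (by norm_num)).2 (by norm_num)
  unfold stencilRoot
  linarith

lemma stencilRoot_lt : stencilRoot < 1 / 2 := by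
  have : 13 / 8 < Real.sqrt 3 := (Real.lt_sqrt (by norm_num)).2 (by norm_num)
  unfold stencilRoot
  linarith

/-- A grid function with two free boundary values and the form `(c + d j) κ ^ j` beyond them. -/
def layer (a b c d : ℝ) : ℕ → ℝ
  | 0 => a
  | 1 => b
  | j + 2 => (c + d * j) * stencilRoot ^ j

lemma memlp_layer (a b c d : ℝ) : Memℓp (layer a b c d) 2 := by
  apply memlp_of_shift 2
  have hk : ‖stencilRoot ^ 2‖ < 1 := by
    rw [Real.norm_of_nonneg (by positivity)]
    nlinarith [stencilRoot_pos, stencilRoot_lt]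
  have h0 : Memℓp (fun j : ℕ => stencilRoot ^ j) 2 := by
    rw [memlp_two_iff]
    refine (summable_geometric_of_norm_lt_one hk).congr fun j => ?_
    rw [← pow_mul, ← pow_mul, mul_comm]
  have h1 : Memℓp (fun j : ℕ => (j : ℝ) * stencilRoot ^ j) 2 := by
    rw [memlp_two_iff]
    refine (summable_pow_mul_geometric_of_norm_lt_one 2 hk).congr fun j => ?_
    rw [mul_pow, ← pow_mul, ← pow_mul, mul_comm 2 j]
  refine ((h0.const_mul c).add (h1.const_mul d)).congr_fun fun j => ?_
  simp only [layer, Pi.add_apply]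
  ring

lemma stencilRoot_cube : stencilRoot ^ 3 = 195 * stencilRoot - 14 := by
  linear_combination (stencilRoot + 14) * stencilRoot_sq

/-- The interior stencil applied to `(c + d j) κ ^ j`. -/
lemma sbpA_layer (a b c d : ℝ) (j : ℕ) :
    sbpA 1 (layer a b c d) (j + 4) = -(14 - 2 * stencilRoot) * d * stencilRoot ^ (j + 2) := by
  simp only [sbpA, layer]
  push_cast
  linear_combination (stencilRoot ^ j * (1 / 12 * (stencilRoot ^ 2 - 2 * stencilRoot + 1)
    * (c + d * j) + d * (1 / 3 * stencilRoot ^ 2 - 4 / 3 * stencilRoot ))) * stencilRoot_sq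

/-- The solution of `A g = d₁` at grid size one. -/
def gridG : GridFun :=
  ⟨layer (-1) (38488 / 69443 - 17 / 1177 * stencilRoot) (-(391 + 34 * stencilRoot) / 1177) 0,
    memlp_layer _ _ _ _⟩

lemma gridG_zero : gridG 0 = -1 := rfl

lemma opA_gridG : opA 1 gridG = gridD1 := by
  apply lp.ext
  funext j
  change sbpA 1 (layer (-1) (38488 / 69443 - 17 / 1177 * stencilRoot)
    (-(391 + 34 * stencilRoot) / 1177) 0) j = sbpD1 1 j
  have h2 := stencilRoot_sq
  have h3 := stencilRoot_cube
  have h4 : stencilRoot ^ 4 = 2716 * stencilRoot - 195 := by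
    linear_combination stencilRoot * h3 + 195 * h2
  rcases j with _ | _ | _ | _ | j
  · simp only [sbpA, layer, sbpD1]
    push_cast
    linear_combination (-17 / 1177 / 24) * h2
  · simp only [sbpA, layer, sbpD1]
    push_cast
    ring
  · simp only [sbpA, layer, sbpD1]
    push_cast
    linear_combination (59 / 48 * 34 / 1177 - 391 / 1177 / 12) * h2 - (34 / 1177 / 12) * h3
  · simp only [sbpA, layer, sbpD1]
    push_cast
    linear_combination (391 / 1177 * 4 / 3 - 34 / 1177 * 59 / 24) * h2
      + (34 / 1177 * 4 / 3 - 391 / 1177 / 12) * h3 - (34 / 1177 / 12) * h4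
  · rw [sbpA_layer]
    simp [sbpD1]

/-- Every grid function that is a multiple of `κ ^ j` away from the boundary is, up to a multiple
of `e₁`, in the range of the difference operator on `ℓ²`. -/
lemma exists_layer (y : GridFun) (η : ℝ) (hy : ∀ j, y (j + 4) = η * stencilRoot ^ (j + 2)) :
    ∃ (φ : GridFun) (α : ℝ), opD 1 φ = α • gridE1 - y := by
  have hk := stencilRoot_lt
  have hk0 := stencilRoot_pos
  have h2 := stencilRoot_sq
  have h3 := stencilRoot_cube
  set κ := stencilRoot with hκ
  have hdet : (2448 - 96 * κ) ≠ 0 := by linarith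
  have hμ : (14 - 2 * κ) ≠ 0 := by linarith
  -- The tail of y is resonant, since κ ^ j is in the kernel of the interior stencil; the term j κ ^
  -- j with amplitude d produces it.
  obtain ⟨d, hd⟩ : ∃ d, (14 - 2 * κ) * d = -η := ⟨-η / (14 - 2 * κ), by field_simp⟩
  set s1 := -y 1
  set s2 := -43 * y 2 - 59 * d * κ + 8 * d * κ ^ 2
  set s3 := -49 * y 3 + 118 * d * κ - 128 * d * κ ^ 2 + 12 * d * κ ^ 3
  -- Row 0 is left to the multiple of e₁. Rows 1, 2, 3 form a linear system for a, b, c; after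
  -- reduction of powers of κ and elimination of a and b, the coefficient of c is 2448 - 96 κ.
  obtain ⟨c, hc⟩ : ∃ c, (2448 - 96 * κ) * c = 51 * (s3 + s1) + 2 * (s2 + 4 * s1) :=
    ⟨(51 * (s3 + s1) + 2 * (s2 + 4 * s1)) / (2448 - 96 * κ), by field_simp⟩
  set b := ((52 - 2 * κ) * c - s3 - s1) / 2 with hb
  set a := s1 + 2 * b - c with ha
  refine ⟨⟨layer a b c d, memlp_layer _ _ _ _⟩, y 0 + sbpD 1 (layer a b c d) 0, ?_⟩
  apply lp.ext
  funext j
  change sbpD 1 (layer a b c d) j = (y 0 + sbpD 1 (layer a b c d) 0) * sbpE1 j - y j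
  rcases j with _ | _ | _ | _ | j
  · simp [sbpE1]
  · simp only [sbpD, sbpH, sbpA, sbpE1, layer, ← hκ]
    push_cast
    linear_combination ha
  · simp only [sbpD, sbpH, sbpA, sbpE1, layer, ← hκ]
    push_cast
    have e2 : -4 * a + 59 * b + (-106 + 3 * κ) * c = s2 := by
      linear_combination (-4) * ha + 51 * hb + (1 / 2) * hc
    linear_combination (1 / 43) * e2 - (4 / 43 * c) * h2
  · simp only [sbpD, sbpH, sbpA, sbpE1, layer, ← hκ]
    push_cast
    have e3 : -a + (51 - 2 * κ) * c = s3 := by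
      linear_combination (-1) * ha - 2 * hb
    linear_combination (1 / 49) * e3 + (64 / 49 * c) * h2 - (4 / 49 * c) * h3
  · have := sbpA_layer a b c d j
    simp only [sbpD, sbpH, sbpE1, this, hy, ← hκ]
    linear_combination κ ^ (j + 2) * hd

/-- The unit grid function at the grid point `k`. -/
abbrev gridUnit (k : ℕ) : GridFun := lp.single 2 k (1 : ℝ)

lemma gridUnit_apply (k j : ℕ) : gridUnit k j = if j = k then 1 else 0 := by
  rw [lp.single_apply, Pi.single_apply]

/-- These layers later absorb the four boundary values of the forcing. -/
lemma exists_unit_layers : ∃ (φ : ℕ → GridFun) (α : ℕ → ℝ),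
    ∀ k < 4, opD 1 (φ k) = α k • gridE1 - gridUnit k := by
  have : ∀ k, ∃ (φ : GridFun) (α : ℝ), k < 4 → opD 1 φ = α • gridE1 - gridUnit k := fun k => by
    by_cases hk : k < 4
    · obtain ⟨φ, α, h⟩ := exists_layer (gridUnit k) 0 (fun j => by
        rw [gridUnit_apply, if_neg (by omega), zero_mul])
      exact ⟨φ, α, fun _ => h⟩
    · exact ⟨0, 0, fun h => absurd h hk⟩
  choose φ α h using this
  exact ⟨φ, α, h⟩

/-- If α were zero, pairing D φ = -g with H g would give -⟨Hg, g⟩ on one side and, by summation by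
parts with A g = d₁ and g₀ = -1, zero on the other. So g would vanish, against g₀ = -1. -/
lemma exists_gridG_layer : ∃ (φ : GridFun) (α : ℝ), α ≠ 0 ∧ opD 1 φ = α • gridE1 - gridG := by
  obtain ⟨φ, α, h⟩ := exists_layer gridG (-(391 + 34 * stencilRoot) / 1177) (fun j => by
    change (_ + 0 * _) * _ = _
    rw [zero_mul, add_zero])
  refine ⟨φ, α, ?_, h⟩
  rintro rfl
  have h1 := inner_opH_opD gridG φ
  rw [h, gridG_zero, inner_opA_comm, opA_gridG, zero_smul, zero_sub, inner_neg_right] at h1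
  have h2 := inner_opH_ge gridG
  have h3 : ‖gridG‖ = 0 := by
    have : ‖gridG‖ ^ 2 = 0 := by nlinarith [sq_nonneg ‖gridG‖]
    exact pow_eq_zero_iff two_ne_zero |>.1 this
  have h4 := gridFun_abs_apply_le gridG 0
  rw [gridG_zero, h3] at h4
  norm_num at h4

/-- A slowly decaying lift of the boundary value one. -/
lemma exists_lift {h : ℝ} (h0 : 0 < h) (h1 : h ≤ 1) : ∃ χ : GridFun, χ 0 = 1 ∧
    Real.sqrt h * ‖χ‖ ≤ 2 ∧ Real.sqrt h * ‖opD 1 χ‖ ≤ 4 * h ^ 2 := by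
  -- The lift is ρ ^ j, a discrete e^{-x}: it decays over a distance of order one in x, so D of it
  -- is O(h²), with 1 - ρ = h ρ exactly.
  set ρ := (1 + h)⁻¹ with hρ
  have hρh : ρ * (1 + h) = 1 := inv_mul_cancel₀ (by positivity)
  have hρ0 : 0 < ρ := by positivity
  have hρ1 : ρ < 1 := by nlinarith
  have hρ2 : 1 / 2 ≤ ρ := by nlinarith
  have hsq : (1 - ρ) ^ 2 = h ^ 2 * ρ ^ 2 := by
    rw [show 1 - ρ = h * ρ by linarith]
    ring
  have hρ21 : ρ ^ 2 < 1 := by nlinarith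
  have hgeo := hasSum_geometric_of_lt_one (by positivity) hρ21
  have hfun : ∀ j : ℕ, (ρ ^ 2) ^ j = (ρ ^ j) ^ 2 := fun j => by
    rw [← pow_mul, ← pow_mul, mul_comm]
  simp only [hfun] at hgeo
  set χ : GridFun := ⟨fun j => ρ ^ j, (memlp_two_iff _).2 hgeo.summable⟩ with hχ
  have hn : h * ‖χ‖ ^ 2 ≤ 2 := by
    rw [gridFun_norm_sq]
    change h * ∑' j : ℕ, (ρ ^ j) ^ 2 ≤ 2
    rw [hgeo.tsum_eq, ← div_eq_mul_inv, div_le_iff₀ (by linarith)]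
    nlinarith
  have hn2 : Real.sqrt h * ‖χ‖ ≤ 2 := by
    refine le_of_sq_le_sq ?_ (by norm_num)
    rw [mul_pow, Real.sq_sqrt h0.le]
    linarith
  refine ⟨χ, pow_zero _, hn2, ?_⟩
  -- Each row of D annihilates constants and linear functions, so it contributes a factor (1 - ρ)² =
  -- h² ρ².
  have hD : ∀ j, |opD 1 χ j| ≤ 2 * h ^ 2 * ρ ^ j := by
    intro j
    change |sbpD 1 (fun j => ρ ^ j) j| ≤ _
    rcases j with _ | _ | _ | _ | j
    · have : sbpD 1 (fun j => ρ ^ j) 0 = h ^ 2 * (ρ ^ 2 * (2 - ρ)) := by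
        simp only [sbpD, sbpH, sbpA, sbpE1, sbpD1Apply_eq]
        linear_combination (2 - ρ) * hsq
      rw [this, abs_of_nonneg (by have : 0 ≤ 2 - ρ := by linarith
                                  positivity)]
      have : ρ ^ 2 * (2 - ρ) ≤ 2 := by nlinarith [mul_nonneg (sub_nonneg.2 hρ21.le) hρ0.le]
      nlinarith [sq_nonneg h]
    · have : sbpD 1 (fun j => ρ ^ j) 1 = h ^ 2 * ρ ^ 2 := by
        simp only [sbpD, sbpH, sbpA, sbpE1, sbpD1Apply_eq]
        linear_combination hsq
      rw [zero_add, this, abs_of_nonneg (by positivity)]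
      nlinarith [mul_nonneg (sq_nonneg h) hρ0.le, mul_nonneg (mul_nonneg (sq_nonneg h) hρ0.le)
        (sub_nonneg.2 hρ1.le)]
    · have : sbpD 1 (fun j => ρ ^ j) 2 = h ^ 2 * ρ ^ 2 * ((-4 + 51 * ρ - 4 * ρ ^ 2) / 43) := by
        simp only [sbpD, sbpH, sbpA, sbpE1, sbpD1Apply_eq]
        linear_combination ((-4 + 51 * ρ - 4 * ρ ^ 2) / 43) * hsq
      rw [zero_add, this, abs_mul, abs_of_nonneg (show 0 ≤ h ^ 2 * ρ ^ 2 by positivity)]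
      have : |(-4 + 51 * ρ - 4 * ρ ^ 2) / 43| ≤ 2 := by
        rw [abs_le]
        constructor <;> nlinarith
      calc h ^ 2 * ρ ^ 2 * _ ≤ h ^ 2 * ρ ^ 2 * 2 := by gcongr
        _ = _ := by norm_num; ring
    · have : sbpD 1 (fun j => ρ ^ j) 3
          = h ^ 2 * ρ ^ 2 * ((-1 - 2 * ρ + 56 * ρ ^ 2 - 4 * ρ ^ 3) / 49) := by
        simp only [sbpD, sbpH, sbpA, sbpE1, sbpD1Apply_eq]
        linear_combination ((-1 - 2 * ρ + 56 * ρ ^ 2 - 4 * ρ ^ 3) / 49) * hsq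
      rw [zero_add, this, abs_mul, abs_of_nonneg (show 0 ≤ h ^ 2 * ρ ^ 2 by positivity)]
      have : |(-1 - 2 * ρ + 56 * ρ ^ 2 - 4 * ρ ^ 3) / 49| ≤ 2 * ρ := by
        rw [abs_le]
        constructor <;> nlinarith [mul_nonneg hρ0.le (sq_nonneg (1 - ρ)),
          mul_nonneg hρ0.le (sub_nonneg.2 hρ1.le), mul_nonneg (sq_nonneg ρ) (sub_nonneg.2 hρ1.le)]
      calc h ^ 2 * ρ ^ 2 * _ ≤ h ^ 2 * ρ ^ 2 * (2 * ρ) := by gcongr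
        _ = _ := by norm_num; ring
    · have : sbpD 1 (fun j => ρ ^ j) (j + 4)
          = ρ ^ (j + 4) * (h ^ 2 * (1 - h ^ 2 * ρ / 12) * ρ) := by
        have e : sbpD 1 (fun j => ρ ^ j) (j + 4)
            = ρ ^ (j + 2) * ((1 - ρ) ^ 2 * ρ - (1 - ρ) ^ 4 / 12) := by
          simp only [sbpD, sbpH, sbpA, sbpE1, sbpD1Apply_eq]
          ring
        rw [e, show (1 - ρ) ^ 4 = ((1 - ρ) ^ 2) ^ 2 by ring, hsq]
        ring
      have hh : h ^ 2 ≤ 1 := by nlinarith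
      have hb : h ^ 2 * ρ / 12 ≤ 1 := by nlinarith
      have hb0 : 0 ≤ h ^ 2 * ρ / 12 := by positivity
      rw [this, abs_of_nonneg (by have := sub_nonneg.2 hb; positivity)]
      have : h ^ 2 * (1 - h ^ 2 * ρ / 12) * ρ ≤ h ^ 2 * 1 * 1 := by
        gcongr
        nlinarith
      nlinarith [pow_pos hρ0 (j + 4), mul_nonneg (pow_pos hρ0 (j + 4)).le (sub_nonneg.2 this),
        mul_nonneg (pow_pos hρ0 (j + 4)).le (sq_nonneg h)]
  have hDn : ‖opD 1 χ‖ ≤ 2 * h ^ 2 * ‖χ‖ := by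
    refine le_of_sq_le_sq ?_ (by positivity)
    rw [mul_pow, gridFun_norm_sq, gridFun_norm_sq, ← tsum_mul_left]
    refine Summable.tsum_le_tsum (fun j => ?_) (gridFun_summable_sq _)
      ((gridFun_summable_sq _).mul_left _)
    rw [← sq_abs, ← mul_pow]
    exact pow_le_pow_left₀ (abs_nonneg _) (hD j) 2
  calc Real.sqrt h * ‖opD 1 χ‖ ≤ Real.sqrt h * (2 * h ^ 2 * ‖χ‖) := by gcongr
    _ = 2 * h ^ 2 * (Real.sqrt h * ‖χ‖) := by ring
    _ ≤ 2 * h ^ 2 * 2 := by gcongr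
    _ = 4 * h ^ 2 := by ring

/-! ### Stability -/

/-- The energy estimate for the semidiscretization with forcing `R` at grid size `h`. -/
lemma energy_estimate {h T b ρ : ℝ} (h0 : 0 < h) (hb : b ≤ 0)
    {z w R : ℝ → GridFun}
    (hz : ∀ t ∈ Icc 0 T, HasDerivWithinAt z (w t + w t 0 • gridG) (Icc 0 T) t)
    (hw : ∀ t ∈ Icc 0 T, HasDerivWithinAt w
      ((h ^ 2)⁻¹ • opD 1 (z t) + (b * w t 0) • gridE1 + R t) (Icc 0 T) t)
    (hR : ∀ t ∈ Icc 0 T, ‖R t‖ ≤ ρ) {t : ℝ} (ht : t ∈ Icc 0 T) :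
    ‖w t‖ ^ 2 ≤ 3 * Real.exp T * (2 * ‖w 0‖ ^ 2 + ‖opA 1‖ * (‖z 0‖ / h) ^ 2 + 12 * ρ ^ 2) := by
  have hT : 0 ≤ T := ht.1.trans ht.2
  -- In the derivative of E the cross terms cancel: the boundary term w₀ ⟨d₁, z⟩ from D meets w₀ ⟨g,
  -- A z⟩ from the equation for z, and A g = d₁.
  set E : ℝ → ℝ := fun t => inner ℝ (opH 1 (w t)) (w t) + (h ^ 2)⁻¹ * inner ℝ (z t) (opA 1 (z t))
    with hE
  set E' : ℝ → ℝ := fun t => 2 * inner ℝ (opH 1 (w t)) (R t) + 2 * (17 / 48) * b * (w t 0) ^ 2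
    with hE'
  have hder : ∀ t ∈ Icc 0 T, HasDerivWithinAt E (E' t) (Icc 0 T) t := by
    intro t ht
    have h1 := ((opH 1).hasFDerivAt.comp_hasDerivWithinAt t (hw t ht)).inner ℝ (hw t ht)
    have h2 := (hz t ht).inner ℝ ((opA 1).hasFDerivAt.comp_hasDerivWithinAt t (hz t ht))
    refine (h1.add (h2.const_mul (h ^ 2)⁻¹)).congr_deriv ?_
    simp only [hE', Function.comp_apply]
    rw [← inner_opH_comm ((h ^ 2)⁻¹ • _ + _ + _) (w t), real_inner_comm (opH 1 (w t)),
      inner_opA_comm (w t + _) (z t), real_inner_comm (z t) (opA 1 (w t + _)),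
      map_add, map_smul, opA_gridG]
    simp only [inner_add_right, inner_smul_right, inner_opH_opD]
    have hHe : inner ℝ (opH 1 (w t)) gridE1 = 17 / 48 * w t 0 := by
      rw [real_inner_comm, inner_gridE1, opH_apply]
      simp [sbpH]
    rw [hHe, real_inner_comm gridD1 (z t), inner_opA_comm (w t) (z t),
      real_inner_comm (z t) (opA 1 (w t))]
    ring
  have hle : ∀ t ∈ Icc 0 T, E' t ≤ E t + 12 * ρ ^ 2 := by
    intro t ht
    have h1 : inner ℝ (opH 1 (w t)) (R t) ≤ 2 * ‖w t‖ * ρ :=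
      (real_inner_le_norm _ _).trans (mul_le_mul (norm_opH_le _) (hR t ht) (norm_nonneg _)
        (by positivity))
    have h2 := inner_opH_ge (w t)
    have h3 : 0 ≤ (h ^ 2)⁻¹ * inner ℝ (z t) (opA 1 (z t)) :=
      mul_nonneg (by positivity) (inner_opA_nonneg _)
    have h4 : b * (w t 0) ^ 2 ≤ 0 := mul_nonpos_of_nonpos_of_nonneg hb (sq_nonneg _)
    simp only [hE, hE']
    -- Young's inequality 4 ‖w‖ ρ ≤ ‖w‖²/3 + 12 ρ², matched to the lower bound 1/3 of H; this is the
    -- source of the 12.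
    nlinarith [sq_nonneg (‖w t‖ - 6 * ρ)]
  have hanti : AntitoneOn (fun t => (E t + 12 * ρ ^ 2) * Real.exp (-t)) (Icc 0 T) := by
    have hd : ∀ t ∈ Icc 0 T, HasDerivWithinAt (fun t => (E t + 12 * ρ ^ 2) * Real.exp (-t))
        (E' t * Real.exp (-t) + (E t + 12 * ρ ^ 2) * (Real.exp (-t) * -1)) (Icc 0 T) t :=
      fun t ht => ((hder t ht).add_const _).mul ((hasDerivAt_neg t).exp.hasDerivWithinAt)
    refine antitoneOn_of_hasDerivWithinAt_nonpos (convex_Icc 0 T)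
      (fun t ht => (hd t ht).continuousWithinAt)
      (fun t ht => (hd t (interior_subset ht)).mono interior_subset) fun t ht => ?_
    have := hle t (interior_subset ht)
    nlinarith [Real.exp_pos (-t)]
  have h1 := hanti (left_mem_Icc.2 hT) ht ht.1
  simp only [neg_zero, Real.exp_zero, mul_one] at h1
  have h2 : E t + 12 * ρ ^ 2 ≤ Real.exp T * (E 0 + 12 * ρ ^ 2) := by
    have h3 : E t + 12 * ρ ^ 2 = Real.exp t * ((E t + 12 * ρ ^ 2) * Real.exp (-t)) := by
      rw [mul_left_comm, ← Real.exp_add, add_neg_cancel, Real.exp_zero, mul_one]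
    have h4 : 0 ≤ E 0 + 12 * ρ ^ 2 := by
      have := inner_opH_ge (w 0)
      have : 0 ≤ (h ^ 2)⁻¹ * inner ℝ (z 0) (opA 1 (z 0)) :=
        mul_nonneg (by positivity) (inner_opA_nonneg _)
      simp only [hE]
      nlinarith [sq_nonneg ‖w 0‖, sq_nonneg ρ]
    rw [h3]
    exact mul_le_mul (Real.exp_le_exp.2 ht.2) h1 (by
      have := Real.exp_pos t
      have h5 : 0 ≤ E t + 12 * ρ ^ 2 := by
        have := inner_opH_ge (w t)
        have : 0 ≤ (h ^ 2)⁻¹ * inner ℝ (z t) (opA 1 (z t)) :=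
          mul_nonneg (by positivity) (inner_opA_nonneg _)
        simp only [hE]
        nlinarith [sq_nonneg ‖w t‖, sq_nonneg ρ]
      positivity) (Real.exp_pos _).le
  have h3 : E 0 ≤ 2 * ‖w 0‖ ^ 2 + ‖opA 1‖ * (‖z 0‖ / h) ^ 2 := by
    refine add_le_add (inner_opH_le _) ?_
    have : inner ℝ (z 0) (opA 1 (z 0)) ≤ ‖z 0‖ * (‖opA 1‖ * ‖z 0‖) :=
      (real_inner_le_norm _ _).trans (by gcongr; exact (opA 1).le_opNorm _)
    calc (h ^ 2)⁻¹ * inner ℝ (z 0) (opA 1 (z 0))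
        ≤ (h ^ 2)⁻¹ * (‖z 0‖ * (‖opA 1‖ * ‖z 0‖)) := by gcongr
      _ = _ := by field_simp
  have h4 : 1 / 3 * ‖w t‖ ^ 2 ≤ E t := by
    have := inner_opH_ge (w t)
    have : 0 ≤ (h ^ 2)⁻¹ * inner ℝ (z t) (opA 1 (z t)) :=
      mul_nonneg (by positivity) (inner_opA_nonneg _)
    simp only [hE]
    linarith
  have h5 : Real.exp T * (E 0 + 12 * ρ ^ 2)
      ≤ Real.exp T * (2 * ‖w 0‖ ^ 2 + ‖opA 1‖ * (‖z 0‖ / h) ^ 2 + 12 * ρ ^ 2) := by gcongr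
  nlinarith [sq_nonneg ρ]

/-! ### Sampling and truncation errors of smooth profiles on the half-line -/

/-- `W k` is the `k`-th derivative of `W 0` on the half-line, and the derivatives of order at most
`N` have `L²` norm at most `M`. -/
structure Profile (N : ℕ) (M : ℝ) (W : ℕ → ℝ → ℝ) : Prop where
  deriv : ∀ k, ∀ x ∈ Ici (0 : ℝ), HasDerivWithinAt (W k) (W (k + 1) x) (Ici 0) x
  bound : ∀ k ≤ N, ∀ Q, 0 ≤ Q → ∫ x in (0 : ℝ)..Q, W k x ^ 2 ≤ M ^ 2

namespace Profile

variable {N : ℕ} {M : ℝ} {W : ℕ → ℝ → ℝ}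

lemma shift (hW : Profile N M W) {m n : ℕ} (h : n + m ≤ N) :
    Profile n M (fun k => W (k + m)) where
  deriv k x hx := by
    have := hW.deriv (k + m) x hx
    rwa [add_right_comm] at this
  bound k hk Q hQ := hW.bound (k + m) (by omega) Q hQ

lemma continuousOn (hW : Profile N M W) (k : ℕ) : ContinuousOn (W k) (Ici 0) :=
  fun x hx => (hW.deriv k x hx).continuousWithinAt

lemma continuousOn_uIcc (hW : Profile N M W) (k : ℕ) {p q : ℝ} (hp : 0 ≤ p) (hq : 0 ≤ q) :
    ContinuousOn (W k) (uIcc p q) :=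
  (hW.continuousOn k).mono fun _ hx => (le_inf hp hq).trans hx.1

lemma intervalIntegrable_sq (hW : Profile N M W) (k : ℕ) {p q : ℝ} (hp : 0 ≤ p) (hq : 0 ≤ q) :
    IntervalIntegrable (fun x => W k x ^ 2) volume p q :=
  ((hW.continuousOn_uIcc k hp hq).pow 2).intervalIntegrable

lemma intervalIntegrable (hW : Profile N M W) (k : ℕ) {p q : ℝ} (hp : 0 ≤ p) (hq : 0 ≤ q) :
    IntervalIntegrable (fun x => W k x ^ 2 + W (k + 1) x ^ 2) volume p q :=
  (hW.intervalIntegrable_sq k hp hq).add (hW.intervalIntegrable_sq (k + 1) hp hq)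

/-- The square of the `H¹` norm of `W k` on `[0, x]`. -/
def energy (W : ℕ → ℝ → ℝ) (k : ℕ) (x : ℝ) : ℝ := ∫ y in (0 : ℝ)..x, (W k y ^ 2 + W (k + 1) y ^ 2)

lemma energy_sub (hW : Profile N M W) (k : ℕ) {p q : ℝ} (hp : 0 ≤ p) (hq : 0 ≤ q) :
    energy W k q - energy W k p = ∫ y in p..q, (W k y ^ 2 + W (k + 1) y ^ 2) :=
  intervalIntegral.integral_interval_sub_left (hW.intervalIntegrable k le_rfl hq)
    (hW.intervalIntegrable k le_rfl hp)

lemma energy_mono (hW : Profile N M W) (k : ℕ) {p q : ℝ} (hp : 0 ≤ p) (hpq : p ≤ q) :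
    energy W k p ≤ energy W k q := by
  rw [← sub_nonneg, hW.energy_sub k hp (hp.trans hpq)]
  exact intervalIntegral.integral_nonneg hpq fun _ _ => by positivity

lemma energy_nonneg {k : ℕ} {q : ℝ} (hq : 0 ≤ q) : 0 ≤ energy W k q :=
  intervalIntegral.integral_nonneg hq fun _ _ => by positivity

lemma energy_le (hW : Profile N M W) {k : ℕ} (hk : k + 1 ≤ N) {q : ℝ} (hq : 0 ≤ q) :
    energy W k q ≤ 2 * M ^ 2 := by
  unfold energy
  rw [intervalIntegral.integral_add
    (hW.intervalIntegrable_sq k le_rfl hq) (hW.intervalIntegrable_sq (k + 1) le_rfl hq)]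
  have h1 := hW.bound k (by omega) q hq
  have h2 := hW.bound (k + 1) hk q hq
  linarith

/-- Integrate (W²)' = 2 W W', which is at most W² + W'² in absolute value. -/
lemma abs_sq_sub_le (hW : Profile N M W) (k : ℕ) {a b : ℝ} (ha : 0 ≤ a) (hab : a ≤ b) :
    |W k b ^ 2 - W k a ^ 2| ≤ energy W k b - energy W k a := by
  have hb := ha.trans hab
  rw [hW.energy_sub k ha hb]
  have h1 : ∫ x in a..b, 2 * W k x * W (k + 1) x = W k b ^ 2 - W k a ^ 2 := by
    refine intervalIntegral.integral_eq_sub_of_hasDerivAt_of_le hab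
      (f := fun x => W k x ^ 2) ?_ (fun x hx => ?_) ?_
    · have := (hW.continuousOn_uIcc k ha hb).pow 2
      rwa [uIcc_of_le hab] at this
    · refine (((hW.deriv k x (ha.trans hx.1.le)).hasDerivAt
        (Ici_mem_nhds (ha.trans_lt hx.1))).fun_pow 2).congr_deriv ?_
      norm_num
    · exact (((hW.continuousOn_uIcc k ha hb).const_mul 2).mul
        (hW.continuousOn_uIcc (k + 1) ha hb)).intervalIntegrable
  rw [← h1]
  refine (intervalIntegral.abs_integral_le_integral_abs hab).trans ?_
  refine intervalIntegral.integral_mono_on hab ?_ (hW.intervalIntegrable k ha hb) fun x _ => ?_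
  · exact (((hW.continuousOn_uIcc k ha hb).const_mul 2).mul
        (hW.continuousOn_uIcc (k + 1) ha hb)).abs.intervalIntegrable
  · rw [abs_le]
    constructor <;> nlinarith [sq_nonneg (W k x + W (k + 1) x), sq_nonneg (W k x - W (k + 1) x)]

/-- Pointwise values are controlled by the `H¹` norm on an interval. -/
lemma sq_le_energy (hW : Profile N M W) (k : ℕ) {p q ξ : ℝ} (hp : 0 ≤ p) (hξ : ξ ∈ Icc p q) :
    (q - p) * W k ξ ^ 2 ≤ (1 + (q - p)) * (energy W k q - energy W k p) := by
  have hpq := hξ.1.trans hξ.2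
  have hq := hp.trans hpq
  -- Values at any two points of the interval are compared; averaging over η then gives the claim.
  have hpt : ∀ η ∈ Icc p q, W k ξ ^ 2 ≤ W k η ^ 2 + (energy W k q - energy W k p) := by
    intro η hη
    rcases le_total ξ η with h | h
    · have h1 := (abs_le.1 (hW.abs_sq_sub_le k (hp.trans hξ.1) h)).1
      have h2 := hW.energy_mono k hp hξ.1
      have h3 := hW.energy_mono k (hp.trans hη.1) hη.2
      linarith
    · have h1 := (abs_le.1 (hW.abs_sq_sub_le k (hp.trans hη.1) h)).2
      have h2 := hW.energy_mono k hp hη.1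
      have h3 := hW.energy_mono k (hp.trans hξ.1) hξ.2
      linarith
  have hi := hW.intervalIntegrable_sq k hp hq
  have h1 := intervalIntegral.integral_mono_on hpq (intervalIntegrable_const)
    (hi.add intervalIntegrable_const) hpt
  have h2 : ∫ x in p..q, W k x ^ 2 ≤ energy W k q - energy W k p := by
    rw [hW.energy_sub k hp hq]
    exact intervalIntegral.integral_mono_on hpq hi (hW.intervalIntegrable k hp hq)
      fun x _ => by nlinarith [sq_nonneg (W (k + 1) x)]
  rw [intervalIntegral.integral_add hi intervalIntegrable_const,
    intervalIntegral.integral_const, intervalIntegral.integral_const, smul_eq_mul,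
    smul_eq_mul] at h1
  linarith

lemma abs_le (hW : Profile N M W) (hM : 0 ≤ M) {k : ℕ} (hk : k + 1 ≤ N) {x : ℝ} (hx : 0 ≤ x) :
    |W k x| ≤ 2 * M := by
  have h1 := hW.sq_le_energy k hx (q := x + 1) (left_mem_Icc.2 (by linarith))
  have h2 := hW.energy_le hk (q := x + 1) (by linarith)
  have h3 : 0 ≤ energy W k x := energy_nonneg hx
  refine abs_le_of_sq_le_sq ?_ (by positivity)
  nlinarith

/-- The pointwise bound on each cell [jh, (j+1)h] makes the sum telescope in the energy. -/
lemma sum_sample_le (hW : Profile N M W) {k : ℕ} (hk : k + 1 ≤ N) {h : ℝ} (h0 : 0 < h)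
    (h1 : h ≤ 1) (J : ℕ) : ∑ j ∈ Finset.range J, h * W k (j * h) ^ 2 ≤ 4 * M ^ 2 := by
  have : ∀ j : ℕ, h * W k (j * h) ^ 2
      ≤ 2 * (energy W k ((j + 1 : ℕ) * h) - energy W k (j * h)) := by
    intro j
    have hj : 0 ≤ (j : ℝ) * h := by positivity
    have e1 := hW.sq_le_energy k hj (q := (j + 1 : ℕ) * h) (ξ := j * h)
      (left_mem_Icc.2 (by push_cast; nlinarith))
    have e2 := hW.energy_mono k hj (q := (j + 1 : ℕ) * h) (by push_cast; nlinarith)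
    rw [show ((j + 1 : ℕ) : ℝ) * h - j * h = h by push_cast; ring] at e1
    nlinarith
  refine (Finset.sum_le_sum fun j _ => this j).trans ?_
  rw [← Finset.mul_sum, Finset.sum_range_sub (fun j : ℕ => energy W k (j * h))]
  have e1 := hW.energy_le hk (q := J * h) (by positivity)
  have e2 : energy W k ((0 : ℕ) * h) = 0 := by simp [energy]
  linarith

lemma memlp_sample (hW : Profile N M W) {k : ℕ} (hk : k + 1 ≤ N) {h : ℝ} (h0 : 0 < h)
    (h1 : h ≤ 1) : Memℓp (fun j : ℕ => W k (j * h)) 2 := by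
  rw [memlp_two_iff]
  refine summable_of_sum_range_le (c := 4 * M ^ 2 / h) (fun _ => sq_nonneg _) fun J => ?_
  rw [le_div_iff₀' h0, Finset.mul_sum]
  exact hW.sum_sample_le hk h0 h1 J

/-- Taylor's formula with remainder. -/
lemma taylor (hW : Profile N M W) {p q B : ℝ} (hp : 0 ≤ p) (n : ℕ) : ∀ k,
    (∀ x ∈ Icc p q, |W (k + n) x| ≤ B) → ∀ x ∈ Icc p q, ∀ y ∈ Icc p q,
      |W k y - ∑ i ∈ Finset.range n, W (k + i) x * (y - x) ^ i / (i.factorial : ℝ)|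
        ≤ B * |y - x| ^ n := by
  induction n with
  | zero =>
    intro k hB x _ y hy
    simpa using hB y hy
  | succ n ih =>
    intro k hB x hx y hy
    have hB0 : 0 ≤ B := (abs_nonneg _).trans (hB x hx)
    have hsub : uIcc x y ⊆ Icc p q := uIcc_subset_Icc hx hy
    set r : ℝ → ℝ := fun z => W k z - ∑ i ∈ Finset.range (n + 1),
      W (k + i) x * (z - x) ^ i / (i.factorial : ℝ) with hr
    have hd : ∀ z ∈ uIcc x y, HasDerivWithinAt r (W (k + 1) z - ∑ i ∈ Finset.range n,
        W (k + 1 + i) x * (z - x) ^ i / (i.factorial : ℝ)) (uIcc x y) z := by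
      intro z hz
      have h1 := (hW.deriv k z (hp.trans (hsub hz).1)).mono
        (fun a ha => hp.trans (hsub ha).1 : uIcc x y ⊆ Ici 0)
      refine h1.sub ?_
      simp only [Finset.sum_range_succ', add_zero, pow_zero, Nat.factorial_zero, Nat.cast_one,
        mul_one, div_one]
      refine HasDerivWithinAt.add_const _ ?_
      refine HasDerivWithinAt.fun_sum fun i _ => ?_
      have h2 := ((((hasDerivAt_id z).sub_const x).pow (i + 1)).const_mul (W (k + (i + 1)) x)
        |>.div_const (((i + 1).factorial : ℕ) : ℝ)).hasDerivWithinAt (s := uIcc x y)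
      refine h2.congr_deriv ?_
      rw [Nat.factorial_succ, add_right_comm, add_assoc]
      push_cast
      simp only [id, mul_one]
      have : (i.factorial : ℝ) ≠ 0 := by positivity
      have : (i : ℝ) + 1 ≠ 0 := by positivity
      field_simp
    have hbd : ∀ z ∈ uIcc x y, ‖W (k + 1) z - ∑ i ∈ Finset.range n,
        W (k + 1 + i) x * (z - x) ^ i / (i.factorial : ℝ)‖ ≤ B * |y - x| ^ n := by
      intro z hz
      refine (ih (k + 1) (fun a ha => ?_) x hx z (hsub hz)).trans ?_
      · have := hB a ha
        rwa [show k + (n + 1) = k + 1 + n by ring] at this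
      · refine mul_le_mul_of_nonneg_left (pow_le_pow_left₀ (abs_nonneg _) ?_ n) hB0
        exact abs_sub_left_of_mem_uIcc hz
    have h3 := (convex_uIcc x y).norm_image_sub_le_of_norm_hasDerivWithin_le hd hbd
      left_mem_uIcc right_mem_uIcc
    have h4 : r x = 0 := by
      simp [hr, Finset.sum_range_succ']
    rw [h4, sub_zero, Real.norm_eq_abs, Real.norm_eq_abs] at h3
    rw [pow_succ, ← mul_assoc]
    exact h3

/-- All four boundary rows are exact on cubics at their grid point, so only the fourth order
remainder of W and the second order remainder of W'' survive. -/
lemma boundary_truncation (hW : Profile N M W) (hM : 0 ≤ M) (hN : 5 ≤ N) {h : ℝ} (h0 : 0 < h)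
    {k : ℕ} (hk : k < 4) :
    |sbpD h (fun j => W 0 (j * h)) k - W 2 (k * h)| ≤ 16000 * M * h ^ 2 := by
  have hB : ∀ x ∈ Icc 0 (5 * h), |W (0 + 4) x| ≤ 2 * M := fun x hx =>
    hW.abs_le hM (by omega) hx.1
  have hB2 : ∀ x ∈ Icc 0 (5 * h), |W (2 + 2) x| ≤ 2 * M := hB
  have h00 : (0 : ℝ) ∈ Icc 0 (5 * h) := ⟨le_rfl, by positivity⟩
  -- Row 3 reaches grid point 5, the furthest needed.
  have hr : ∀ m : ℕ, m ≤ 5 → ∃ r, |r| ≤ 1250 * M * h ^ 4 ∧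
      W 0 (m * h) = W 0 0 + W 1 0 * (m * h) + W 2 0 * (m * h) ^ 2 / 2
        + W 3 0 * (m * h) ^ 3 / 6 + r := by
    intro m hm
    have hm' : (m : ℝ) ≤ 5 := by exact_mod_cast hm
    have := hW.taylor le_rfl 4 0 hB 0 h00 (m * h) ⟨by positivity, by gcongr⟩
    simp only [Finset.sum_range_succ, Finset.sum_range_zero, Nat.factorial, sub_zero] at this
    refine ⟨_, this.trans ?_, by push_cast; ring⟩
    rw [abs_of_nonneg (by positivity)]
    calc 2 * M * (m * h) ^ 4 ≤ 2 * M * (5 * h) ^ 4 := by gcongr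
      _ = 1250 * M * h ^ 4 := by ring
  have hs : ∃ s, |s| ≤ 18 * M * h ^ 2 ∧ W 2 (k * h) = W 2 0 + W 3 0 * (k * h) + s := by
    have hk' : (k : ℝ) ≤ 3 := by exact_mod_cast (by omega : k ≤ 3)
    have := hW.taylor le_rfl 2 2 hB2 0 h00 (k * h) ⟨by positivity, by nlinarith⟩
    simp only [Finset.sum_range_succ, Finset.sum_range_zero, Nat.factorial, sub_zero] at this
    refine ⟨_, this.trans ?_, by push_cast; ring⟩
    rw [abs_of_nonneg (by positivity)]
    calc 2 * M * (k * h) ^ 2 ≤ 2 * M * (3 * h) ^ 2 := by gcongr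
      _ = 18 * M * h ^ 2 := by ring
  obtain ⟨s, hs1, hs2⟩ := hs
  obtain ⟨r0, b0, e0⟩ := hr 0 (by norm_num)
  obtain ⟨r1, b1, e1⟩ := hr 1 (by norm_num)
  obtain ⟨r2, b2, e2⟩ := hr 2 (by norm_num)
  obtain ⟨r3, b3, e3⟩ := hr 3 (by norm_num)
  obtain ⟨r4, b4, e4⟩ := hr 4 (by norm_num)
  obtain ⟨r5, b5, e5⟩ := hr 5 (by norm_num)
  suffices H : ∃ r, |r| ≤ 15000 * M * h ^ 4 ∧
      sbpD h (fun j => W 0 (j * h)) k - W 2 (k * h) = r / h ^ 2 - s by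
    obtain ⟨r, hr1, hr2⟩ := H
    rw [hr2]
    refine (abs_sub _ _).trans ?_
    have : |r / h ^ 2| ≤ 15000 * M * h ^ 2 := by
      rw [abs_div, abs_of_nonneg (by positivity : 0 ≤ h ^ 2), div_le_iff₀ (by positivity)]
      linarith [show 15000 * M * h ^ 2 * h ^ 2 = 15000 * M * h ^ 4 by ring]
    nlinarith [mul_nonneg hM (sq_nonneg h)]
  rw [hs2, sbpD_eq_div]
  have hne : h ≠ 0 := h0.ne'
  have hMh : 0 ≤ M * h ^ 4 := by positivity
  rw [_root_.abs_le] at b0 b1 b2 b3 b4 b5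
  interval_cases k
  · refine ⟨2 * r0 - 5 * r1 + 4 * r2 - r3, ?_, ?_⟩
    · rw [_root_.abs_le]; constructor <;> linarith
    · simp only [sbpD, sbpH, sbpA, sbpE1, sbpD1Apply_eq, e0, e1, e2, e3]
      push_cast
      field_simp
      ring
  · refine ⟨r0 - 2 * r1 + r2, ?_, ?_⟩
    · rw [_root_.abs_le]; constructor <;> linarith
    · simp only [sbpD, sbpH, sbpA, sbpE1, sbpD1Apply_eq, e0, e1, e2, e3]
      push_cast
      field_simp
      ring
  · refine ⟨(-4 * r0 + 59 * r1 - 110 * r2 + 59 * r3 - 4 * r4) / 43, ?_, ?_⟩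
    · rw [_root_.abs_le]; constructor <;> linarith
    · simp only [sbpD, sbpH, sbpA, sbpE1, sbpD1Apply_eq, e0, e1, e2, e3, e4]
      push_cast
      field_simp
      ring
  · refine ⟨(-r0 + 59 * r2 - 118 * r3 + 64 * r4 - 4 * r5) / 49, ?_, ?_⟩
    · rw [_root_.abs_le]; constructor <;> linarith
    · simp only [sbpD, sbpH, sbpA, sbpE1, sbpD1Apply_eq, e0, e1, e2, e3, e4, e5]
      push_cast
      field_simp
      ring

/-- The bound B is local to the five-point stencil, so that the squared errors can later be summed
over j. -/
lemma interior_truncation (hW : Profile N M W) {h B : ℝ} (h0 : 0 < h) (j : ℕ)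
    (hB : ∀ x ∈ Icc (((j + 2 : ℕ) : ℝ) * h) ((j + 6 : ℕ) * h), |W 6 x| ≤ B) :
    |sbpD h (fun j => W 0 (j * h)) (j + 4) - W 2 ((j + 4 : ℕ) * h)| ≤ 200 * B * h ^ 4 := by
  set x : ℝ := (j + 4 : ℕ) * h with hx
  have hB0 : 0 ≤ B := (abs_nonneg _).trans (hB x ⟨by rw [hx]; gcongr; omega,
    by rw [hx]; gcongr; omega⟩)
  have hr : ∀ (i : ℕ) (m : ℝ), ((i : ℕ) : ℝ) * h = x + m * h → |m| ≤ 2 →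
      ∃ r, |r| ≤ 64 * B * h ^ 6 ∧
      W 0 (i * h) = W 0 x + W 1 x * (m * h) + W 2 x * (m * h) ^ 2 / 2
        + W 3 x * (m * h) ^ 3 / 6 + W 4 x * (m * h) ^ 4 / 24 + W 5 x * (m * h) ^ 5 / 120 + r := by
    intro i m him hm
    have hm' := _root_.abs_le.1 hm
    have := hW.taylor (by positivity) 6 0 hB x ⟨by rw [hx]; gcongr; omega,
      by rw [hx]; gcongr; omega⟩ (i * h) (by
        rw [him, hx]
        push_cast
        constructor <;> nlinarith)
    rw [show (i : ℝ) * h - x = m * h by linarith] at this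
    simp only [Finset.sum_range_succ, Finset.sum_range_zero, Nat.factorial] at this
    refine ⟨_, this.trans ?_, by push_cast; ring⟩
    rw [abs_mul, abs_of_pos h0]
    calc B * (|m| * h) ^ 6 ≤ B * (2 * h) ^ 6 := by gcongr
      _ = 64 * B * h ^ 6 := by ring
  obtain ⟨r2, b2, e2⟩ := hr (j + 2) (-2) (by rw [hx]; push_cast; ring) (by norm_num)
  obtain ⟨r3, b3, e3⟩ := hr (j + 3) (-1) (by rw [hx]; push_cast; ring) (by norm_num)
  obtain ⟨r4, b4, e4⟩ := hr (j + 4) 0 (by rw [hx]; push_cast; ring) (by norm_num)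
  obtain ⟨r5, b5, e5⟩ := hr (j + 5) 1 (by rw [hx]; push_cast; ring) (by norm_num)
  obtain ⟨r6, b6, e6⟩ := hr (j + 6) 2 (by rw [hx]; push_cast; ring) (by norm_num)
  have key : sbpD h (fun j => W 0 (j * h)) (j + 4) - W 2 x
      = (-1 / 12 * r2 + 4 / 3 * r3 - 5 / 2 * r4 + 4 / 3 * r5 - 1 / 12 * r6) / h ^ 2 := by
    have hne : h ≠ 0 := h0.ne'
    rw [sbpD_eq_div]
    simp only [sbpD, sbpH, sbpA, sbpE1, e2, e3, e4, e5, e6]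
    field_simp
    ring
  have hBh : 0 ≤ B * h ^ 6 := by positivity
  rw [key, abs_div, abs_of_nonneg (by positivity : 0 ≤ h ^ 2), div_le_iff₀ (by positivity)]
  rw [_root_.abs_le] at b2 b3 b4 b5 b6
  rw [show 200 * B * h ^ 4 * h ^ 2 = 200 * (B * h ^ 6) by ring, _root_.abs_le]
  -- `e4` forces the central remainder to vanish; the other four give 64 · 17/6 < 200.
  constructor <;> linarith

end Profile

/-! ### Partial derivatives on a closed strip -/

section Strip

variable {T : ℝ} {F G : ℝ × ℝ → ℝ}

/-- The closed half-strip `[0, ∞) × [0, T]`. -/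
abbrev strip (T : ℝ) : Set (ℝ × ℝ) := Ici 0 ×ˢ Icc 0 T

lemma uniqueDiffOn_strip (hT : 0 < T) : UniqueDiffOn ℝ (strip T) :=
  (uniqueDiffOn_Ici 0).prod (uniqueDiffOn_Icc hT)

lemma strip_subset_closure_interior (hT : 0 < T) : strip T ⊆ closure (interior (strip T)) := by
  rw [interior_prod_eq, closure_prod_eq, interior_Ici, interior_Icc, closure_Ioi,
    closure_Ioo hT.ne]

lemma hasDerivWithinAt_strip_fst (hF : DifferentiableOn ℝ F (strip T)) {x t : ℝ}
    (hx : x ∈ Ici (0 : ℝ)) (ht : t ∈ Icc 0 T) :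
    HasDerivWithinAt (fun y => F (y, t)) (fderivWithin ℝ F (strip T) (x, t) (1, 0)) (Ici 0) x := by
  have h1 : HasDerivWithinAt (fun y : ℝ => (y, t)) ((1 : ℝ), (0 : ℝ)) (Ici 0) x :=
    (hasDerivWithinAt_id x _).prodMk (hasDerivWithinAt_const _ _ _)
  have hm : MapsTo (fun y : ℝ => (y, t)) (Ici 0) (strip T) := fun y hy => ⟨hy, ht⟩
  exact (hF (x, t) ⟨hx, ht⟩).hasFDerivWithinAt.comp_hasDerivWithinAt x h1 hm

lemma hasDerivWithinAt_strip_snd (hF : DifferentiableOn ℝ F (strip T)) {x t : ℝ}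
    (hx : x ∈ Ici (0 : ℝ)) (ht : t ∈ Icc 0 T) :
    HasDerivWithinAt (fun τ => F (x, τ)) (fderivWithin ℝ F (strip T) (x, t) (0, 1)) (Icc 0 T) t := by
  have h1 : HasDerivWithinAt (fun τ : ℝ => (x, τ)) ((0 : ℝ), (1 : ℝ)) (Icc 0 T) t :=
    (hasDerivWithinAt_const _ _ _).prodMk (hasDerivWithinAt_id t _)
  have hm : MapsTo (fun τ : ℝ => (x, τ)) (Icc 0 T) (strip T) := fun τ hτ => ⟨hx, hτ⟩
  exact (hF (x, t) ⟨hx, ht⟩).hasFDerivWithinAt.comp_hasDerivWithinAt t h1 hm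

lemma derivWithin_strip_fst (hF : DifferentiableOn ℝ F (strip T)) {x t : ℝ}
    (hx : x ∈ Ici (0 : ℝ)) (ht : t ∈ Icc 0 T) :
    derivWithin (fun y => F (y, t)) (Ici 0) x = fderivWithin ℝ F (strip T) (x, t) (1, 0) :=
  (hasDerivWithinAt_strip_fst hF hx ht).derivWithin (uniqueDiffOn_Ici 0 x hx)

lemma contDiffOn_fderivWithin_strip (hT : 0 < T) (hF : ContDiffOn ℝ ∞ F (strip T)) :
    ContDiffOn ℝ ∞ (fderivWithin ℝ F (strip T)) (strip T) :=
  hF.fderivWithin (uniqueDiffOn_strip hT) (by norm_num)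

lemma contDiffOn_strip_derivWithin (hT : 0 < T) (hF : ContDiffOn ℝ ∞ F (strip T)) :
    ContDiffOn ℝ ∞ (fun p => derivWithin (fun y => F (y, p.2)) (Ici 0) p.1) (strip T) := by
  refine ((contDiffOn_fderivWithin_strip hT hF).clm_apply
    (contDiffOn_const (c := ((1 : ℝ), (0 : ℝ))))).congr fun p hp => ?_
  exact derivWithin_strip_fst (hF.differentiableOn (by simp)) hp.1 hp.2

/-- Mixed partial derivatives agree also at the edges, because the strip lies in the closure of its
interior. -/
lemma hasDerivWithinAt_strip_comm (hT : 0 < T) (hF : ContDiffOn ℝ ∞ F (strip T))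
    (hG : ContDiffOn ℝ ∞ G (strip T))
    (hFG : ∀ x ∈ Ici (0 : ℝ), ∀ t ∈ Icc 0 T,
      HasDerivWithinAt (fun τ => F (x, τ)) (G (x, t)) (Icc 0 T) t) {x t : ℝ}
    (hx : x ∈ Ici (0 : ℝ)) (ht : t ∈ Icc 0 T) :
    HasDerivWithinAt (fun τ => derivWithin (fun y => F (y, τ)) (Ici 0) x)
      (derivWithin (fun y => G (y, t)) (Ici 0) x) (Icc 0 T) t := by
  have hFd := hF.differentiableOn (by simp)
  have hGd := hG.differentiableOn (by simp)
  have hF' := (contDiffOn_fderivWithin_strip hT hF).differentiableOn (by simp)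
  have hS := uniqueDiffOn_strip hT
  have hp : (x, t) ∈ strip T := ⟨hx, ht⟩
  have hGF : ∀ p ∈ strip T, G p = fderivWithin ℝ F (strip T) p (0, 1) := fun p hp =>
    (uniqueDiffOn_Icc hT p.2 hp.2).eq_deriv _ (hFG p.1 hp.1 p.2 hp.2)
      (hasDerivWithinAt_strip_snd hFd hp.1 hp.2)
  have hv : ∀ v : ℝ × ℝ, HasFDerivWithinAt (fun p => fderivWithin ℝ F (strip T) p v)
      ((ContinuousLinearMap.apply ℝ ℝ v).comp
        (fderivWithin ℝ (fderivWithin ℝ F (strip T)) (strip T) (x, t))) (strip T) (x, t) :=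
    fun v => (ContinuousLinearMap.apply ℝ ℝ v).hasFDerivAt.comp_hasFDerivWithinAt _
      (hF' _ hp).hasFDerivWithinAt
  have hsymm := (hF (x, t) hp).isSymmSndFDerivWithinAt
    (by simpa using (WithTop.coe_le_coe.2 le_top : ((2 : ℕ∞) : WithTop ℕ∞) ≤ ∞)) hS
    (strip_subset_closure_interior hT hp) hp
  have hGx : derivWithin (fun y => G (y, t)) (Ici 0) x
      = fderivWithin ℝ (fderivWithin ℝ F (strip T)) (strip T) (x, t) (0, 1) (1, 0) := by
    rw [derivWithin_strip_fst hGd hx ht, fderivWithin_congr hGF (hGF _ hp),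
      (hv (0, 1)).fderivWithin (hS _ hp)]
    exact hsymm.eq (1, 0) (0, 1)
  have h1 : HasDerivWithinAt (fun τ : ℝ => (x, τ)) ((0 : ℝ), (1 : ℝ)) (Icc 0 T) t :=
    (hasDerivWithinAt_const _ _ _).prodMk (hasDerivWithinAt_id t _)
  have hm : MapsTo (fun τ : ℝ => (x, τ)) (Icc 0 T) (strip T) := fun τ hτ => ⟨hx, hτ⟩
  have h2 := (hv (1, 0)).comp_hasDerivWithinAt t h1 hm
  rw [hGx]
  refine h2.congr (fun τ hτ => ?_) ?_
  · exact derivWithin_strip_fst hFd hx hτ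
  · exact derivWithin_strip_fst hFd hx ht

end Strip

/-- The `k`-th derivative in `x` on the half-line. -/
def xDeriv (F : ℝ → ℝ → ℝ) (t : ℝ) (k : ℕ) (x : ℝ) : ℝ :=
  iteratedDerivWithin k (fun y => F y t) (Ici 0) x

lemma xDeriv_zero (F : ℝ → ℝ → ℝ) (t x : ℝ) : xDeriv F t 0 x = F x t := by
  simp [xDeriv]

lemma xDeriv_succ (F : ℝ → ℝ → ℝ) (t : ℝ) (k : ℕ) (x : ℝ) :
    xDeriv F t (k + 1) x = derivWithin (fun y => xDeriv F t k y) (Ici 0) x := by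
  rw [xDeriv, iteratedDerivWithin_succ]
  rfl

lemma contDiffOn_xDeriv {T : ℝ} (hT : 0 < T) {F : ℝ → ℝ → ℝ}
    (hF : ContDiffOn ℝ ∞ (fun p : ℝ × ℝ => F p.1 p.2) (strip T)) (k : ℕ) :
    ContDiffOn ℝ ∞ (fun p : ℝ × ℝ => xDeriv F p.2 k p.1) (strip T) := by
  induction k with
  | zero => simpa only [xDeriv_zero] using hF
  | succ n ih =>
    simp only [xDeriv_succ]
    exact contDiffOn_strip_derivWithin hT ih

lemma hasDerivWithinAt_xDeriv {T : ℝ} (hT : 0 < T) {F : ℝ → ℝ → ℝ}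
    (hF : ContDiffOn ℝ ∞ (fun p : ℝ × ℝ => F p.1 p.2) (strip T)) (k : ℕ) {t x : ℝ}
    (ht : t ∈ Icc 0 T) (hx : x ∈ Ici (0 : ℝ)) :
    HasDerivWithinAt (xDeriv F t k) (xDeriv F t (k + 1) x) (Ici 0) x := by
  have := (contDiffOn_xDeriv hT hF k).differentiableOn (by simp)
  rw [xDeriv_succ]
  exact (hasDerivWithinAt_strip_fst this hx ht).differentiableWithinAt.hasDerivWithinAt

/-- Used with m = 0 for U_t = V and with m = 2 for V_t = U_xx; the time derivative is commuted past
one x-derivative at a time. -/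
lemma hasDerivWithinAt_xDeriv_time {T : ℝ} (hT : 0 < T) {F G : ℝ → ℝ → ℝ} {m : ℕ}
    (hF : ContDiffOn ℝ ∞ (fun p : ℝ × ℝ => F p.1 p.2) (strip T))
    (hG : ContDiffOn ℝ ∞ (fun p : ℝ × ℝ => G p.1 p.2) (strip T))
    (hFG : ∀ x ∈ Ici (0 : ℝ), ∀ t ∈ Icc 0 T,
      HasDerivWithinAt (fun τ => F x τ) (xDeriv G t m x) (Icc 0 T) t) (k : ℕ) :
    ∀ x ∈ Ici (0 : ℝ), ∀ t ∈ Icc 0 T,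
      HasDerivWithinAt (fun τ => xDeriv F τ k x) (xDeriv G t (k + m) x) (Icc 0 T) t := by
  induction k with
  | zero => simpa only [xDeriv_zero, zero_add] using hFG
  | succ n ih =>
    intro x hx t ht
    rw [show n + 1 + m = n + m + 1 by ring, xDeriv_succ]
    simp only [xDeriv_succ]
    exact hasDerivWithinAt_strip_comm hT (contDiffOn_xDeriv hT hF n)
      (contDiffOn_xDeriv hT hG (n + m)) ih hx ht

lemma integral_sq_le_of_eLpNorm_le {w : ℝ → ℝ} {M : ℝ} (hM : 0 ≤ M)
    (hw : ContinuousOn w (Ici 0))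
    (hb : eLpNorm w 2 (volume.restrict (Ici 0)) ≤ ENNReal.ofReal M) {Q : ℝ} (hQ : 0 ≤ Q) :
    ∫ x in (0 : ℝ)..Q, w x ^ 2 ≤ M ^ 2 := by
  have hmem : MemLp w 2 (volume.restrict (Ici 0)) :=
    ⟨hw.aestronglyMeasurable measurableSet_Ici, hb.trans_lt ENNReal.ofReal_lt_top⟩
  have h1 : ∫ x in Ici (0 : ℝ), w x ^ 2 ≤ M ^ 2 := by
    have e := hmem.eLpNorm_eq_integral_rpow_norm (by norm_num) (by norm_num)
    rw [e] at hb
    have h2 := (ENNReal.ofReal_le_ofReal_iff hM).1 hb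
    simp only [ENNReal.toReal_ofNat, Real.rpow_ofNat, Real.norm_eq_abs, sq_abs] at h2
    have h0 : 0 ≤ ∫ x in Ici (0 : ℝ), w x ^ 2 := integral_nonneg fun _ => sq_nonneg _
    have h3 := pow_le_pow_left₀ (by positivity) h2 2
    rwa [← Real.rpow_natCast, ← Real.rpow_mul h0, show (2 : ℝ)⁻¹ * ((2 : ℕ) : ℝ) = 1 by norm_num,
      Real.rpow_one] at h3
  refine le_trans ?_ h1
  rw [intervalIntegral.integral_of_le hQ]
  exact setIntegral_mono_set hmem.integrable_sq (ae_of_all _ fun _ => sq_nonneg _)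
    (Ioc_subset_Ioi_self.trans Ioi_subset_Ici_self).eventuallyLE

lemma profile_xDeriv {T : ℝ} (hT : 0 < T) {F : ℝ → ℝ → ℝ} {N : ℕ} {M : ℝ} (hM : 0 ≤ M)
    (hF : ContDiffOn ℝ ∞ (fun p : ℝ × ℝ => F p.1 p.2) (strip T)) (hb : SobolevBound N T M F)
    {t : ℝ} (ht : t ∈ Icc 0 T) : Profile N M (xDeriv F t) where
  deriv k _ hx := hasDerivWithinAt_xDeriv hT hF k ht hx
  bound k hk _ hQ := integral_sq_le_of_eLpNorm_le hM
    (fun _ hx => (hasDerivWithinAt_xDeriv hT hF k ht hx).continuousWithinAt) (hb t ht k hk) hQ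

/-! ### Differentiability in `ℓ²` from coordinatewise differentiability -/

lemma norm_sum_gridUnit_le (u : GridFun) (s : Finset ℕ) :
    ‖∑ j ∈ s, u j • gridUnit j‖ ≤ ‖u‖ := by
  have h1 := lp.norm_sum_single (p := 2) (by norm_num) (fun j => u j) s
  have h2 := lp.sum_rpow_le_norm_rpow (p := 2) (by norm_num) u s
  rw [← h1] at h2
  have e : ∀ j, u j • gridUnit j = lp.single 2 j (u j) := fun j => by
    rw [gridUnit, ← lp.single_smul, smul_eq_mul, mul_one]
  simp only [e]
  simp only [ENNReal.toReal_ofNat, Real.rpow_ofNat] at h2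
  exact le_of_sq_le_sq h2 (norm_nonneg _)

lemma hasSum_gridUnit (u : GridFun) : HasSum (fun j => u j • gridUnit j) u := by
  have h1 := lp.hasSum_single (p := 2) (by norm_num) u
  have e : ∀ j, u j • gridUnit j = lp.single 2 j (u j) := fun j => by
    rw [gridUnit, ← lp.single_smul, smul_eq_mul, mul_one]
  simpa only [e] using h1

/-- The mean value inequality holds for truncations to finitely many coordinates, uniformly, and
passes to the limit. -/
lemma grid_norm_sub_le {T B : ℝ} {P Q : ℝ → GridFun}
    (hP : ∀ t ∈ Icc 0 T, ∀ j, HasDerivWithinAt (fun τ => P τ j) (Q t j) (Icc 0 T) t)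
    {s t : ℝ} (hs : s ∈ Icc 0 T) (ht : t ∈ Icc 0 T) (hB : ∀ τ ∈ uIcc s t, ‖Q τ‖ ≤ B) :
    ‖P t - P s‖ ≤ B * |t - s| := by
  refine le_of_tendsto' (hasSum_gridUnit (P t - P s)).norm fun S => ?_
  have hsub : uIcc s t ⊆ Icc 0 T := uIcc_subset_Icc hs ht
  have h1 : ∀ τ ∈ uIcc s t, HasDerivWithinAt (fun τ => ∑ j ∈ S, P τ j • gridUnit j)
      (∑ j ∈ S, Q τ j • gridUnit j) (uIcc s t) τ := fun τ hτ =>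
    HasDerivWithinAt.fun_sum fun j _ => ((hP τ (hsub hτ) j).mono hsub).smul_const _
  have h2 := (convex_uIcc s t).norm_image_sub_le_of_norm_hasDerivWithin_le h1
    (fun τ hτ => (norm_sum_gridUnit_le _ S).trans (hB τ hτ)) left_mem_uIcc right_mem_uIcc
  rw [← Finset.sum_sub_distrib] at h2
  simpa [sub_smul] using h2

/-- A second coordinatewise derivative bounded in `ℓ²` yields a quadratic Taylor remainder in norm,
by applying the mean value inequality twice. -/
lemma grid_hasDerivWithinAt {T B : ℝ} {P Q R : ℝ → GridFun}
    (hP : ∀ t ∈ Icc 0 T, ∀ j, HasDerivWithinAt (fun τ => P τ j) (Q t j) (Icc 0 T) t)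
    (hQ : ∀ t ∈ Icc 0 T, ∀ j, HasDerivWithinAt (fun τ => Q τ j) (R t j) (Icc 0 T) t)
    (hR : ∀ t ∈ Icc 0 T, ‖R t‖ ≤ B) {s : ℝ} (hs : s ∈ Icc 0 T) :
    HasDerivWithinAt P (Q s) (Icc 0 T) s := by
  have hmain : ∀ t ∈ Icc 0 T, ‖P t - P s - (t - s) • Q s‖ ≤ B * |t - s| ^ 2 := by
    intro t ht
    have hsub : uIcc s t ⊆ Icc 0 T := uIcc_subset_Icc hs ht
    have h1 : ∀ τ ∈ Icc 0 T, ∀ j, HasDerivWithinAt (fun τ => (P τ - τ • Q s) j)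
        ((Q τ - Q s) j) (Icc 0 T) τ := fun τ hτ j => by
      refine ((hP τ hτ j).sub
        (((hasDerivAt_id τ).mul_const (Q s j)).hasDerivWithinAt)).congr_deriv ?_
      change Q τ j - 1 * Q s j = Q τ j - Q s j
      rw [one_mul]
    have h2 : ∀ τ ∈ uIcc s t, ‖Q τ - Q s‖ ≤ B * |t - s| := fun τ hτ => by
      have hB : 0 ≤ B := (norm_nonneg _).trans (hR s hs)
      refine (grid_norm_sub_le hQ hs (hsub hτ) fun a ha => hR a ?_).trans ?_
      · exact uIcc_subset_Icc hs (hsub hτ) ha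
      · exact mul_le_mul_of_nonneg_left (abs_sub_left_of_mem_uIcc hτ) hB
    have h3 := grid_norm_sub_le (P := fun τ => P τ - τ • Q s) (Q := fun τ => Q τ - Q s) h1 hs ht h2
    rw [show P t - P s - (t - s) • Q s = P t - t • Q s - (P s - s • Q s) by module, pow_two,
      ← mul_assoc]
    exact h3
  rw [hasDerivWithinAt_iff_isLittleO]
  refine Asymptotics.IsBigO.trans_isLittleO (g := fun t => (t - s) ^ 2) ?_ ?_
  · refine Asymptotics.IsBigO.of_bound B ?_
    filter_upwards [self_mem_nhdsWithin] with t ht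
    rw [norm_pow, Real.norm_eq_abs]
    exact hmain t ht
  · refine Asymptotics.IsLittleO.mono ?_ nhdsWithin_le_nhds
    have h1 : Tendsto (fun t : ℝ => t - s) (𝓝 s) (𝓝 0) := by
      have : Continuous fun t : ℝ => t - s := by fun_prop
      simpa using this.tendsto s
    have := (Asymptotics.isLittleO_pow_id (𝕜 := ℝ) (n := 2) (by norm_num)).comp_tendsto h1
    simpa [Function.comp_def] using this

/-! ### Linear evolution equations -/

/-- Duhamel's formula with the exponential of the bounded operator L. -/
lemma exists_linear_evolution {E : Type*} [NormedAddCommGroup E] [NormedSpace ℝ E]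
    [CompleteSpace E] (L : E →L[ℝ] E) {F : ℝ → E} (hF : Continuous F) (y₀ : E) :
    ∃ y : ℝ → E, y 0 = y₀ ∧ ∀ t, HasDerivAt y (L (y t) + F t) t := by
  have hexp : ∀ t : ℝ, HasDerivAt (fun s : ℝ => NormedSpace.exp (s • L))
      (L * NormedSpace.exp (t • L)) t := fun t => hasDerivAt_exp_smul_const' (𝕂 := ℝ) L t
  have hexp' : ∀ t : ℝ, HasDerivAt (fun s : ℝ => NormedSpace.exp (s • (-L)))
      (-L * NormedSpace.exp (t • (-L))) t := fun t => hasDerivAt_exp_smul_const' (𝕂 := ℝ) (-L) t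
  have hcont : Continuous fun s : ℝ => NormedSpace.exp (s • (-L)) (F s) :=
    (continuous_iff_continuousAt.2 fun s => (hexp' s).continuousAt).clm_apply hF
  refine ⟨fun t => NormedSpace.exp (t • L)
    (y₀ + ∫ s in (0 : ℝ)..t, NormedSpace.exp (s • (-L)) (F s)), ?_, fun t => ?_⟩
  · simp
  · have h1 := (hexp t).clm_apply ((hcont.integral_hasStrictDerivAt 0 t).hasDerivAt.const_add y₀)
    refine h1.congr_deriv ?_
    have h2 : NormedSpace.exp (t • L) * NormedSpace.exp (t • (-L)) = 1 := by
      let := NormedAlgebra.restrictScalars ℚ ℝ (E →L[ℝ] E)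
      rw [← NormedSpace.exp_add_of_commute
        (((Commute.refl L).neg_right.smul_left t).smul_right t), smul_neg, add_neg_cancel,
        NormedSpace.exp_zero]
    have h3 : NormedSpace.exp (t • L) (NormedSpace.exp (t • (-L)) (F t)) = F t := by
      rw [← mul_apply_eq_comp, h2, one_apply_eq_self]
    rw [h3]
    rfl

/-! ### Boundary layer correctors -/

lemma exists_antiderivative {E : Type*} [NormedAddCommGroup E] [NormedSpace ℝ E] [CompleteSpace E]
    {T : ℝ} (hT : 0 ≤ T) {f : ℝ → E} (hf : ContinuousOn f (Icc 0 T)) :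
    ∃ F : ℝ → E, F 0 = 0 ∧ ∀ t ∈ Icc 0 T, HasDerivWithinAt F (f t) (Icc 0 T) t := by
  have hc : Continuous (IccExtend hT ((Icc 0 T).domRestrict f)) :=
    (continuousOn_iff_continuous_domRestrict.1 hf).Icc_extend'
  refine ⟨fun t => ∫ s in (0 : ℝ)..t, IccExtend hT ((Icc 0 T).domRestrict f) s, by simp,
    fun t ht => ?_⟩
  refine (hc.integral_hasStrictDerivAt 0 t).hasDerivAt.hasDerivWithinAt.congr_deriv ?_
  exact IccExtend_of_mem hT _ ht

lemma norm_sub_le_of_hasDerivWithinAt {E : Type*} [NormedAddCommGroup E] [NormedSpace ℝ E]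
    {T C : ℝ} {f f' : ℝ → E} (hf : ∀ t ∈ Icc 0 T, HasDerivWithinAt f (f' t) (Icc 0 T) t)
    (hC : ∀ t ∈ Icc 0 T, ‖f' t‖ ≤ C) {t : ℝ} (ht : t ∈ Icc 0 T) : ‖f t - f 0‖ ≤ C * T := by
  have h0 : (0 : ℝ) ∈ Icc 0 T := left_mem_Icc.2 (ht.1.trans ht.2)
  have := (convex_Icc 0 T).norm_image_sub_le_of_norm_hasDerivWithin_le hf hC h0 ht
  refine this.trans ?_
  rw [sub_zero, Real.norm_of_nonneg ht.1]
  exact mul_le_mul_of_nonneg_left ht.2 ((norm_nonneg _).trans (hC t ht))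

lemma hasDerivWithinAt_apply {s : Set ℝ} {t : ℝ} {P : ℝ → GridFun} {P' : GridFun}
    (h : HasDerivWithinAt P P' s t) (k : ℕ) : HasDerivWithinAt (fun τ => P τ k) (P' k) s t :=
  (lp.evalCLM ℝ (fun _ : ℕ => ℝ) 2 k).hasFDerivAt.comp_hasDerivWithinAt t h

/-- A linear combination of four boundary layers and one further layer. -/
def layerComb (ψ : ℕ → GridFun) (ψg : GridFun) (s : ℕ → ℝ) (p : ℝ) : GridFun :=
  ∑ k ∈ Finset.range 4, s k • ψ k - p • ψg

lemma norm_layerComb_le {ψ : ℕ → GridFun} {ψg : GridFun} {s : ℕ → ℝ} {p c : ℝ}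
    (hs : ∀ k < 4, |s k| ≤ c) (hp : |p| ≤ c) :
    ‖layerComb ψ ψg s p‖ ≤ c * (∑ k ∈ Finset.range 4, ‖ψ k‖ + ‖ψg‖) := by
  refine (norm_sub_le _ _).trans ?_
  rw [mul_add, Finset.mul_sum]
  refine add_le_add ((norm_sum_le _ _).trans (Finset.sum_le_sum fun k hk => ?_)) ?_
  · rw [norm_smul]
    exact mul_le_mul_of_nonneg_right (hs k (Finset.mem_range.1 hk)) (norm_nonneg _)
  · rw [norm_smul]
    exact mul_le_mul_of_nonneg_right hp (norm_nonneg _)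

lemma hasDerivWithinAt_layerComb {S : Set ℝ} {t : ℝ} (ψ : ℕ → GridFun) (ψg : GridFun)
    {s s' : ℕ → ℝ → ℝ} {p : ℝ → ℝ} {p' : ℝ}
    (hs : ∀ k < 4, HasDerivWithinAt (s k) (s' k t) S t) (hp : HasDerivWithinAt p p' S t) :
    HasDerivWithinAt (fun τ => layerComb ψ ψg (fun k => s k τ) (p τ))
      (layerComb ψ ψg (fun k => s' k t) p') S t :=
  (HasDerivWithinAt.fun_sum fun k hk =>
    (hs k (Finset.mem_range.1 hk)).smul_const (ψ k)).sub (hp.smul_const ψg)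

/-- The projection of a grid function that removes the four boundary values. -/
def interiorPart : GridFun →L[ℝ] GridFun :=
  ContinuousLinearMap.id ℝ GridFun
    - ∑ k ∈ Finset.range 4, (lp.evalCLM ℝ (fun _ : ℕ => ℝ) 2 k).smulRight (gridUnit k)

lemma interiorPart_apply (u : GridFun) :
    interiorPart u = u - ∑ k ∈ Finset.range 4, u k • gridUnit k := by
  simp only [interiorPart, sub_apply, ContinuousLinearMap.id_apply,
    sum_apply, ContinuousLinearMap.smulRight_apply]
  rfl

/-- The corrector cancels the boundary part of the forcing and leaves multiples of e₁ and g, plus a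
term in D χ that is small because the lift is slow. -/
lemma opD_layerComb {φ : ℕ → GridFun} {α : ℕ → ℝ} {φg : GridFun} {αg : ℝ}
    (hφ : ∀ k < 4, opD 1 (φ k) = α k • gridE1 - gridUnit k)
    (hφg : opD 1 φg = αg • gridE1 - gridG) (χ : GridFun) (s : ℕ → ℝ) (p : ℝ) :
    opD 1 (layerComb (fun k => φ k - φ k 0 • χ) (φg - φg 0 • χ) s p)
      = (∑ k ∈ Finset.range 4, s k * α k - p * αg) • gridE1
        - ∑ k ∈ Finset.range 4, s k • gridUnit k + p • gridG
        - (∑ k ∈ Finset.range 4, s k * φ k 0 - p * φg 0) • opD 1 χ := by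
  have hk : ∀ k ∈ Finset.range 4, s k • (opD 1 (φ k) - φ k 0 • opD 1 χ)
      = (s k * α k) • gridE1 - s k • gridUnit k - (s k * φ k 0) • opD 1 χ := fun k hk => by
    rw [hφ k (Finset.mem_range.1 hk)]
    module
  simp only [layerComb, map_sub, map_sum, map_smul, hφg]
  rw [Finset.sum_congr rfl hk, Finset.sum_sub_distrib, Finset.sum_sub_distrib,
    ← Finset.sum_smul, ← Finset.sum_smul]
  module

lemma sqrt_mul_norm_sub_lift_le {h : ℝ} (h1 : h ≤ 1) {χ : GridFun}
    (hχ : Real.sqrt h * ‖χ‖ ≤ 2) (u : GridFun) : Real.sqrt h * ‖u - u 0 • χ‖ ≤ 3 * ‖u‖ := by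
  have hs1 : Real.sqrt h ≤ 1 := Real.sqrt_le_one.2 h1
  have e1 : ‖u - u 0 • χ‖ ≤ ‖u‖ + |u 0| * ‖χ‖ := by
    refine (norm_sub_le _ _).trans ?_
    rw [norm_smul, Real.norm_eq_abs]
  have e2 := gridFun_abs_apply_le u 0
  calc Real.sqrt h * ‖u - u 0 • χ‖ ≤ Real.sqrt h * (‖u‖ + |u 0| * ‖χ‖) := by gcongr
    _ = Real.sqrt h * ‖u‖ + |u 0| * (Real.sqrt h * ‖χ‖) := by ring
    _ ≤ 1 * ‖u‖ + ‖u‖ * 2 := by gcongr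
    _ = 3 * ‖u‖ := by ring

set_option maxHeartbeats 1000000 in
/-- The semidiscretization is stable with respect to the forcing `σ` integrated in time: of the four
boundary values of `σ` only `h²` times their size enters, provided that the amplitudes `p` and `a`
of the correctors balance the remaining force at the boundary point. -/
lemma exists_corrected_estimate : ∃ (α : ℕ → ℝ) (αg : ℝ), αg ≠ 0 ∧ ∀ T : ℝ, ∃ K : ℝ, 0 ≤ K ∧
    ∀ (h b m : ℝ) (x y σ : ℝ → GridFun) (τ₀ τ₁ : ℕ → ℝ → ℝ) (p p₁ p₂ a a₁ : ℝ → ℝ) (c : ℝ),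
    0 < h → h ≤ 1 → b ≤ 0 → 0 ≤ c → h ^ 2 * c ≤ m →
    x 0 = 0 → y 0 = 0 → σ 0 = 0 →
    (∀ t ∈ Icc 0 T, HasDerivWithinAt x (y t + y t 0 • gridG) (Icc 0 T) t) →
    (∀ t ∈ Icc 0 T, HasDerivWithinAt y
      ((h ^ 2)⁻¹ • opD 1 (x t) + (b * y t 0) • gridE1 + σ t) (Icc 0 T) t) →
    (∀ t ∈ Icc 0 T, Real.sqrt h * ‖interiorPart (σ t)‖ ≤ m) →
    (∀ k < 4, ∀ t ∈ Icc 0 T, HasDerivWithinAt (fun τ => σ τ k) (τ₀ k t) (Icc 0 T) t ∧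
      HasDerivWithinAt (τ₀ k) (τ₁ k t) (Icc 0 T) t ∧ |σ t k| ≤ c ∧ |τ₀ k t| ≤ c ∧ |τ₁ k t| ≤ c) →
    (∀ t ∈ Icc 0 T, HasDerivWithinAt p (p₁ t) (Icc 0 T) t ∧
      HasDerivWithinAt p₁ (p₂ t) (Icc 0 T) t ∧ HasDerivWithinAt a (a₁ t) (Icc 0 T) t ∧
      |p t| ≤ c ∧ |p₁ t| ≤ c ∧ |p₂ t| ≤ c ∧ |p t - a₁ t| ≤ m ∧
      ∑ k ∈ Finset.range 4, σ t k * α k - p t * αg - b * a t = 0) →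
    |a 0| ≤ m → h * |p 0| ≤ m →
    ∀ t ∈ Icc 0 T, Real.sqrt h * ‖y t + y t 0 • gridG‖ ≤ K * m := by
  obtain ⟨φ, α, hφ⟩ := exists_unit_layers
  obtain ⟨φg, αg, hαg, hφg⟩ := exists_gridG_layer
  refine ⟨α, αg, hαg, fun T => ?_⟩
  set Φ := ∑ k ∈ Finset.range 4, ‖φ k‖ + ‖φg‖ with hΦ
  have hΦ0 : 0 ≤ Φ := by positivity
  -- 1 bounds the interior forcing, ‖g‖ the multiple of g, and 7 Φ = 4 Φ + 3 Φ the lift term and the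
  -- second time derivative of the corrector.
  set Γ := 1 + ‖gridG‖ + 7 * Φ with hΓ
  have hΓ0 : 0 ≤ Γ := by positivity
  set L := Real.sqrt (3 * Real.exp T * (14 + ‖opA 1‖)) with hL
  refine ⟨(1 + ‖gridG‖) * (L * Γ) + Γ, by positivity, ?_⟩
  intro h b m x y σ τ₀ τ₁ p p₁ p₂ a a₁ c h0 h1 hb hc hcm hx0 hy0 hσ0 hx hy hint hτ hp ha0 hp0 t ht
  have hT0 : (0 : ℝ) ∈ Icc 0 T := left_mem_Icc.2 (ht.1.trans ht.2)
  have hm : 0 ≤ m := (abs_nonneg _).trans ha0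
  obtain ⟨χ, hχ0, hχ1, hχ2⟩ := exists_lift h0 h1
  have hs1 : Real.sqrt h ≤ 1 := Real.sqrt_le_one.2 h1
  have hsp : 0 < Real.sqrt h := Real.sqrt_pos.2 h0
  set ψ : ℕ → GridFun := fun k => φ k - φ k 0 • χ with hψ
  set ψg : GridFun := φg - φg 0 • χ with hψg
  have hlift := sqrt_mul_norm_sub_lift_le h1 hχ1
  have hcomb : ∀ (s : ℕ → ℝ) (q : ℝ), (∀ k < 4, |s k| ≤ c) → |q| ≤ c →
      Real.sqrt h * ‖h ^ 2 • layerComb ψ ψg s q‖ ≤ 3 * Φ * m := by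
    intro s q hs hq
    rw [norm_smul, Real.norm_of_nonneg (by positivity)]
    have e1 : Real.sqrt h * (∑ k ∈ Finset.range 4, ‖ψ k‖ + ‖ψg‖) ≤ 3 * Φ := by
      rw [hΦ, mul_add, mul_add, Finset.mul_sum, Finset.mul_sum]
      exact add_le_add (Finset.sum_le_sum fun k _ => hlift (φ k)) (hlift φg)
    calc Real.sqrt h * (h ^ 2 * ‖layerComb ψ ψg s q‖)
        ≤ Real.sqrt h * (h ^ 2 * (c * (∑ k ∈ Finset.range 4, ‖ψ k‖ + ‖ψg‖))) := by
          gcongr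
          exact norm_layerComb_le hs hq
      _ = (h ^ 2 * c) * (Real.sqrt h * (∑ k ∈ Finset.range 4, ‖ψ k‖ + ‖ψg‖)) := by ring
      _ ≤ m * (3 * Φ) := by gcongr
      _ = 3 * Φ * m := by ring
  set X : ℝ → GridFun := fun t => h ^ 2 • layerComb ψ ψg (fun k => σ t k) (p t) with hX
  set X₁ : ℝ → GridFun := fun t => h ^ 2 • layerComb ψ ψg (fun k => τ₀ k t) (p₁ t) with hX₁
  set X₂ : ℝ → GridFun := fun t => h ^ 2 • layerComb ψ ψg (fun k => τ₁ k t) (p₂ t) with hX₂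
  have hXd : ∀ t ∈ Icc 0 T, HasDerivWithinAt X (X₁ t) (Icc 0 T) t := fun t ht =>
    (hasDerivWithinAt_layerComb ψ ψg (s := fun k τ => σ τ k) (s' := τ₀)
      (fun k hk => (hτ k hk t ht).1) (hp t ht).1).const_smul (h ^ 2)
  have hX₁d : ∀ t ∈ Icc 0 T, HasDerivWithinAt X₁ (X₂ t) (Icc 0 T) t := fun t ht =>
    (hasDerivWithinAt_layerComb ψ ψg (s := τ₀) (s' := τ₁)
      (fun k hk => (hτ k hk t ht).2.1) (hp t ht).2.1).const_smul (h ^ 2)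
  -- Vanishing at the boundary point keeps the layers out of w₀, so they produce no extra multiple
  -- of g or of e₁ in the equations for z and w.
  have hψ0 : ∀ s q, layerComb ψ ψg s q 0 = 0 := by
    intro s q
    have e : ∀ u : GridFun, (u - u 0 • χ) 0 = 0 := fun u => by
      change u 0 - u 0 * χ 0 = 0
      rw [hχ0]
      ring
    simp only [layerComb, Finset.sum_range_succ, Finset.sum_range_zero]
    change 0 + s 0 * ψ 0 0 + s 1 * ψ 1 0 + s 2 * ψ 2 0 + s 3 * ψ 3 0 - q * ψg 0 = 0
    simp only [hψ, hψg, e]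
    ring
  have hX₁0 : ∀ t, X₁ t 0 = 0 := fun t => by
    change h ^ 2 * layerComb ψ ψg _ _ 0 = 0
    rw [hψ0, mul_zero]
  set z : ℝ → GridFun := fun t => x t - X t with hz
  set w : ℝ → GridFun := fun t => y t - (X₁ t + a t • gridG) with hw
  -- Since g₀ = -1, the contribution a g to y cancels in y + y₀ g, so a is free in the equation for
  -- z.
  have hw0 : ∀ t, w t 0 = y t 0 + a t := fun t => by
    change y t 0 - (X₁ t 0 + a t * gridG 0) = _
    rw [hX₁0, gridG_zero]
    ring
  set R : ℝ → GridFun := fun t =>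
    σ t + (h ^ 2)⁻¹ • opD 1 (X t) - (b * a t) • gridE1 - X₂ t - a₁ t • gridG with hR
  have hzd : ∀ t ∈ Icc 0 T, HasDerivWithinAt z (w t + w t 0 • gridG) (Icc 0 T) t := by
    intro t ht
    refine ((hx t ht).sub (hXd t ht)).congr_deriv ?_
    rw [hw0]
    simp only [hw]
    module
  have hwd : ∀ t ∈ Icc 0 T, HasDerivWithinAt w
      ((h ^ 2)⁻¹ • opD 1 (z t) + (b * w t 0) • gridE1 + R t) (Icc 0 T) t := by
    intro t ht
    refine ((hy t ht).sub ((hX₁d t ht).add ((hp t ht).2.2.1.smul_const gridG))).congr_deriv ?_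
    rw [hw0]
    simp only [hz, hR, map_sub]
    module
  -- The balance condition on p and a removes the e₁ component, which is not multiplied by any small
  -- factor.
  have hReq : ∀ t ∈ Icc 0 T, R t = interiorPart (σ t) + (p t - a₁ t) • gridG
      - (∑ k ∈ Finset.range 4, σ t k * φ k 0 - p t * φg 0) • opD 1 χ - X₂ t := by
    intro t ht
    have e1 : (h ^ 2)⁻¹ • opD 1 (X t) = opD 1 (layerComb ψ ψg (fun k => σ t k) (p t)) := by
      rw [hX, map_smul, smul_smul, inv_mul_cancel₀ (by positivity), one_smul]
    have e2 := (hp t ht).2.2.2.2.2.2.2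
    have e3 : b * a t = ∑ k ∈ Finset.range 4, σ t k * α k - p t * αg := by linarith
    simp only [hR]
    rw [e1, e3, interiorPart_apply]
    rw [hψ, hψg, opD_layerComb hφ hφg]
    module
  have hRn : ∀ t ∈ Icc 0 T, ‖R t‖ ≤ Γ * m / Real.sqrt h := by
    intro t ht
    obtain ⟨-, -, -, b1, b2, b3, b4, -⟩ := hp t ht
    rw [le_div_iff₀' hsp, hReq t ht]
    have n1 : ‖(p t - a₁ t) • gridG‖ ≤ m * ‖gridG‖ := by
      rw [norm_smul]
      exact mul_le_mul_of_nonneg_right b4 (norm_nonneg _)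
    have n2 : |∑ k ∈ Finset.range 4, σ t k * φ k 0 - p t * φg 0| ≤ c * Φ := by
      refine (abs_sub _ _).trans ?_
      rw [hΦ, mul_add, Finset.mul_sum]
      refine add_le_add ((Finset.abs_sum_le_sum_abs _ _).trans (Finset.sum_le_sum fun k hk => ?_)) ?_
      · rw [abs_mul]
        exact mul_le_mul (hτ k (Finset.mem_range.1 hk) t ht).2.2.1 (gridFun_abs_apply_le _ _)
          (abs_nonneg _) hc
      · rw [abs_mul]
        exact mul_le_mul b1 (gridFun_abs_apply_le _ _) (abs_nonneg _) hc
    have n3 : Real.sqrt h * ‖(∑ k ∈ Finset.range 4, σ t k * φ k 0 - p t * φg 0) • opD 1 χ‖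
        ≤ 4 * Φ * m := by
      rw [norm_smul, Real.norm_eq_abs]
      calc Real.sqrt h * (|∑ k ∈ Finset.range 4, σ t k * φ k 0 - p t * φg 0| * ‖opD 1 χ‖)
          = |∑ k ∈ Finset.range 4, σ t k * φ k 0 - p t * φg 0| * (Real.sqrt h * ‖opD 1 χ‖) := by
            ring
        _ ≤ (c * Φ) * (4 * h ^ 2) := by gcongr
        _ = 4 * Φ * (h ^ 2 * c) := by ring
        _ ≤ 4 * Φ * m := by gcongr
    have n4 := hcomb (fun k => τ₁ k t) (p₂ t) (fun k hk => (hτ k hk t ht).2.2.2.2) b3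
    have n5 : Real.sqrt h * (m * ‖gridG‖) ≤ 1 * (m * ‖gridG‖) := by gcongr
    have n6 := hint t ht
    calc _ ≤ Real.sqrt h * (‖interiorPart (σ t)‖ + ‖(p t - a₁ t) • gridG‖
          + ‖(∑ k ∈ Finset.range 4, σ t k * φ k 0 - p t * φg 0) • opD 1 χ‖ + ‖X₂ t‖) := by
            gcongr
            refine (norm_sub_le _ _).trans ?_
            gcongr
            refine (norm_sub_le _ _).trans ?_
            gcongr
            exact norm_add_le _ _
      _ ≤ Real.sqrt h * (‖interiorPart (σ t)‖ + m * ‖gridG‖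
          + ‖(∑ k ∈ Finset.range 4, σ t k * φ k 0 - p t * φg 0) • opD 1 χ‖ + ‖X₂ t‖) := by
            gcongr
      _ ≤ Γ * m := by
            rw [hΓ]
            linarith
  have hw0n : Real.sqrt h * ‖w 0‖ ≤ Γ * m := by
    have n1 := hcomb (fun k => τ₀ k 0) (p₁ 0) (fun k hk => (hτ k hk 0 hT0).2.2.2.1)
      (hp 0 hT0).2.2.2.2.1
    have n2 : ‖a 0 • gridG‖ ≤ m * ‖gridG‖ := by
      rw [norm_smul]
      exact mul_le_mul_of_nonneg_right ha0 (norm_nonneg _)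
    simp only [hw, hy0, zero_sub, norm_neg]
    calc Real.sqrt h * ‖X₁ 0 + a 0 • gridG‖
        ≤ Real.sqrt h * (‖X₁ 0‖ + m * ‖gridG‖) := by
          gcongr
          exact (norm_add_le _ _).trans (by gcongr)
      _ = Real.sqrt h * ‖X₁ 0‖ + Real.sqrt h * (m * ‖gridG‖) := by ring
      _ ≤ 3 * Φ * m + 1 * (m * ‖gridG‖) := by gcongr
      _ ≤ Γ * m := by
          rw [hΓ]
          nlinarith [mul_nonneg hΦ0 hm]
  have hz0n : Real.sqrt h * (‖z 0‖ / h) ≤ Γ * m := by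
    -- As σ(0) = 0, only the layer of g is present initially; the factor 1/h of z in the energy
    -- explains the condition on h |p(0)|.
    have e1 : z 0 = (h ^ 2 * p 0) • ψg := by
      simp only [hz, hX, hx0, hσ0, layerComb]
      change 0 - h ^ 2 • (∑ k ∈ Finset.range 4, (0 : ℝ) • ψ k - p 0 • ψg) = _
      simp only [zero_smul, Finset.sum_const_zero, zero_sub, smul_neg, neg_neg, smul_smul]
    have e2 : ‖φg‖ ≤ Φ := by
      rw [hΦ]
      have : 0 ≤ ∑ k ∈ Finset.range 4, ‖φ k‖ := by positivity
      linarith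
    rw [e1, norm_smul, Real.norm_eq_abs, abs_mul, abs_of_nonneg (by positivity : 0 ≤ h ^ 2)]
    calc Real.sqrt h * (h ^ 2 * |p 0| * ‖ψg‖ / h)
        = (h * |p 0|) * (Real.sqrt h * ‖ψg‖) := by field_simp
      _ ≤ m * (3 * ‖φg‖) := mul_le_mul hp0 (hlift φg) (by positivity) hm
      _ ≤ m * (3 * Φ) := by gcongr
      _ ≤ Γ * m := by
          rw [hΓ]
          nlinarith [mul_nonneg hΦ0 hm, mul_nonneg (norm_nonneg gridG) hm]
  have hwt : Real.sqrt h * ‖w t‖ ≤ L * Γ * m := by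
    have key := energy_estimate h0 hb hzd hwd hRn ht
    refine le_of_sq_le_sq ?_ (by positivity)
    have q1 := pow_le_pow_left₀ (by positivity) hw0n 2
    have q2 := pow_le_pow_left₀ (by positivity) hz0n 2
    rw [mul_pow, Real.sq_sqrt h0.le] at q1 q2
    have q3 : h * (Γ * m / Real.sqrt h) ^ 2 = (Γ * m) ^ 2 := by
      rw [div_pow, Real.sq_sqrt h0.le]
      field_simp
    rw [mul_pow, mul_pow, mul_pow, Real.sq_sqrt h0.le, hL, Real.sq_sqrt (by positivity)]
    calc h * ‖w t‖ ^ 2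
        ≤ h * (3 * Real.exp T * (2 * ‖w 0‖ ^ 2 + ‖opA 1‖ * (‖z 0‖ / h) ^ 2
          + 12 * (Γ * m / Real.sqrt h) ^ 2)) := by gcongr
      _ = 3 * Real.exp T * (2 * (h * ‖w 0‖ ^ 2) + ‖opA 1‖ * (h * (‖z 0‖ / h) ^ 2)
          + 12 * (h * (Γ * m / Real.sqrt h) ^ 2)) := by ring
      _ ≤ 3 * Real.exp T * (2 * (Γ * m) ^ 2 + ‖opA 1‖ * (Γ * m) ^ 2 + 12 * (Γ * m) ^ 2) := by
          rw [q3]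
          gcongr
      _ = 3 * Real.exp T * (14 + ‖opA 1‖) * Γ ^ 2 * m ^ 2 := by ring
  have hfin : y t + y t 0 • gridG = w t + w t 0 • gridG + X₁ t := by
    rw [hw0]
    simp only [hw]
    module
  have n1 := hcomb (fun k => τ₀ k t) (p₁ t) (fun k hk => (hτ k hk t ht).2.2.2.1)
      (hp t ht).2.2.2.2.1
  have n2 : ‖w t 0 • gridG‖ ≤ ‖w t‖ * ‖gridG‖ := by
    rw [norm_smul]
    exact mul_le_mul_of_nonneg_right (gridFun_abs_apply_le _ _) (norm_nonneg _)
  rw [hfin]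
  calc Real.sqrt h * ‖w t + w t 0 • gridG + X₁ t‖
      ≤ Real.sqrt h * (‖w t‖ + ‖w t‖ * ‖gridG‖ + ‖X₁ t‖) := by
        gcongr
        exact (norm_add_le _ _).trans (add_le_add ((norm_add_le _ _).trans (by gcongr)) le_rfl)
    _ = (1 + ‖gridG‖) * (Real.sqrt h * ‖w t‖) + Real.sqrt h * ‖X₁ t‖ := by ring
    _ ≤ (1 + ‖gridG‖) * (L * Γ * m) + 3 * Φ * m := by gcongr
    _ ≤ ((1 + ‖gridG‖) * (L * Γ) + Γ) * m := by
        rw [hΓ]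
        nlinarith [mul_nonneg hΦ0 hm, mul_nonneg (norm_nonneg gridG) hm]

lemma abs_sum_mul_le {n : ℕ} {s α : ℕ → ℝ} {c : ℝ} (hs : ∀ k < n, |s k| ≤ c) :
    |∑ k ∈ Finset.range n, s k * α k| ≤ c * ∑ k ∈ Finset.range n, |α k| := by
  rw [Finset.mul_sum]
  refine (Finset.abs_sum_le_sum_abs _ _).trans (Finset.sum_le_sum fun k hk => ?_)
  rw [abs_mul]
  exact mul_le_mul_of_nonneg_right (hs k (Finset.mem_range.1 hk)) (abs_nonneg _)

/-- Let s = ∑ σ_k α_k. The amplitudes should satisfy αg p + b a = s and p = a'. For β = 0 this is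
solved exactly. For β < 0 it is a stiff equation for a, solved approximately by p = s'/b and a = (s
- αg p)/b: the first relation is exact and the defect of the second is αg s''/b² = O(h² c). The
bound on p'' then calls for three derivatives of σ. -/
lemma exists_forcing_estimate {β : ℝ} (hβ : β ≤ 0) (T : ℝ) : ∃ K : ℝ, 0 ≤ K ∧
    ∀ (h m : ℝ) (x y σ : ℝ → GridFun) (τ₀ τ₁ τ₂ : ℕ → ℝ → ℝ) (c : ℝ),
    0 < h → h ≤ 1 → 0 ≤ c → h ^ 2 * c ≤ m → x 0 = 0 → y 0 = 0 → σ 0 = 0 →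
    (∀ t ∈ Icc 0 T, HasDerivWithinAt x (y t + y t 0 • gridG) (Icc 0 T) t) →
    (∀ t ∈ Icc 0 T, HasDerivWithinAt y
      ((h ^ 2)⁻¹ • opD 1 (x t) + (48 / 17 * β / h * y t 0) • gridE1 + σ t) (Icc 0 T) t) →
    (∀ t ∈ Icc 0 T, Real.sqrt h * ‖interiorPart (σ t)‖ ≤ m) →
    (∀ k < 4, ∀ t ∈ Icc 0 T, HasDerivWithinAt (fun τ => σ τ k) (τ₀ k t) (Icc 0 T) t ∧
      HasDerivWithinAt (τ₀ k) (τ₁ k t) (Icc 0 T) t ∧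
      HasDerivWithinAt (τ₁ k) (τ₂ k t) (Icc 0 T) t ∧
      |σ t k| ≤ c ∧ |τ₀ k t| ≤ c ∧ |τ₁ k t| ≤ c ∧ |τ₂ k t| ≤ c) →
    ∀ t ∈ Icc 0 T, Real.sqrt h * ‖y t + y t 0 • gridG‖ ≤ K * m := by
  obtain ⟨α, αg, hαg, hK⟩ := exists_corrected_estimate
  obtain ⟨K, hK0, hK⟩ := hK T
  set A := ∑ k ∈ Finset.range 4, |α k| with hA
  have hA0 : 0 ≤ A := by positivity
  have hdot : ∀ {s s' : ℕ → ℝ → ℝ} {t : ℝ},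
      (∀ k < 4, HasDerivWithinAt (s k) (s' k t) (Icc 0 T) t) →
      HasDerivWithinAt (fun τ => ∑ k ∈ Finset.range 4, s k τ * α k)
        (∑ k ∈ Finset.range 4, s' k t * α k) (Icc 0 T) t := fun hs =>
    HasDerivWithinAt.fun_sum fun k hk => (hs k (Finset.mem_range.1 hk)).mul_const (α k)
  -- For β < 0 each division by b = b₀ / h gains a factor h; `hp1` and `hp2` count one and two such
  -- divisions.
  rcases hβ.lt_or_eq with hβ | rfl
  · set b₀ := 48 / 17 * β with hb₀
    have hb0 : 0 < |b₀| := abs_pos.2 (by rw [hb₀]; exact (mul_neg_of_pos_of_neg (by norm_num) hβ).ne)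
    set Q := 1 + A / |b₀| + |αg| * A / |b₀| ^ 2 with hQ
    refine ⟨K * Q, by positivity, ?_⟩
    intro h m x y σ τ₀ τ₁ τ₂ c h0 h1 hc hcm hx0 hy0 hσ0 hx hy hint hτ t ht
    have hm : 0 ≤ m := le_trans (by positivity) hcm
    have hT0 : (0 : ℝ) ∈ Icc 0 T := left_mem_Icc.2 (ht.1.trans ht.2)
    set b := b₀ / h with hb
    have hbn : b < 0 := div_neg_of_neg_of_pos (mul_neg_of_pos_of_neg (by norm_num) hβ) h0
    have hdiv : ∀ s C : ℝ, |s| ≤ C → |s / b| ≤ C * h / |b₀| := fun s C hs => by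
      rw [hb, abs_div, abs_div, abs_of_pos h0, div_div_eq_mul_div]
      gcongr
    have hc1 : c * A * h / |b₀| ≤ c * (1 + A / |b₀|) := by
      calc c * A * h / |b₀| ≤ c * A * 1 / |b₀| := by gcongr
        _ = c * (A / |b₀|) := by ring
        _ ≤ c * (1 + A / |b₀|) := by gcongr; linarith
    have hp1 : ∀ s : ℕ → ℝ, (∀ k < 4, |s k| ≤ c) →
        |(∑ k ∈ Finset.range 4, s k * α k) / b| ≤ c * A * h / |b₀| := fun s hs =>
      hdiv _ _ (abs_sum_mul_le hs)
    have hp2 : ∀ s : ℕ → ℝ, (∀ k < 4, |s k| ≤ c) →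
        |αg * ((∑ k ∈ Finset.range 4, s k * α k) / b) / b| ≤ m * Q := fun s hs => by
      have e1 : |αg * ((∑ k ∈ Finset.range 4, s k * α k) / b)| ≤ |αg| * (c * A * h / |b₀|) := by
        rw [abs_mul]
        exact mul_le_mul_of_nonneg_left (hp1 s hs) (abs_nonneg _)
      calc _ ≤ |αg| * (c * A * h / |b₀|) * h / |b₀| := hdiv _ _ e1
        _ = (h ^ 2 * c) * (|αg| * A / |b₀| ^ 2) := by field_simp
        _ ≤ m * Q := by
          gcongr
          rw [hQ]
          have : 0 ≤ 1 + A / |b₀| := by positivity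
          linarith
    rw [mul_assoc, mul_comm Q]
    refine hK h b (m * Q) x y σ τ₀ τ₁
      (fun t => (∑ k ∈ Finset.range 4, τ₀ k t * α k) / b)
      (fun t => (∑ k ∈ Finset.range 4, τ₁ k t * α k) / b)
      (fun t => (∑ k ∈ Finset.range 4, τ₂ k t * α k) / b)
      (fun t => (∑ k ∈ Finset.range 4, σ t k * α k
        - αg * ((∑ k ∈ Finset.range 4, τ₀ k t * α k) / b)) / b)
      (fun t => (∑ k ∈ Finset.range 4, τ₀ k t * α k
        - αg * ((∑ k ∈ Finset.range 4, τ₁ k t * α k) / b)) / b)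
      (c * (1 + A / |b₀|)) h0 h1 hbn.le (by positivity) ?_ hx0 hy0 hσ0 hx hy ?_ ?_ ?_ ?_ ?_ t ht
    · calc h ^ 2 * (c * (1 + A / |b₀|)) = h ^ 2 * c * (1 + A / |b₀|) := by ring
        _ ≤ m * Q := by
          gcongr
          rw [hQ]
          have : 0 ≤ |αg| * A / |b₀| ^ 2 := by positivity
          linarith
    · intro t ht
      refine (hint t ht).trans (le_mul_of_one_le_right hm ?_)
      rw [hQ]
      have : 0 ≤ A / |b₀| + |αg| * A / |b₀| ^ 2 := by positivity
      linarith
    · intro k hk t ht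
      obtain ⟨d0, d1, -, c0, c1, c2, -⟩ := hτ k hk t ht
      have hcc : c ≤ c * (1 + A / |b₀|) := le_mul_of_one_le_right hc (by
        have : 0 ≤ A / |b₀| := by positivity
        linarith)
      exact ⟨d0, d1, c0.trans hcc, c1.trans hcc, c2.trans hcc⟩
    · intro t ht
      refine ⟨(hdot fun k hk => (hτ k hk t ht).2.1).div_const b,
        (hdot fun k hk => (hτ k hk t ht).2.2.1).div_const b,
        ((hdot (s := fun k τ => σ τ k) fun k hk => (hτ k hk t ht).1).sub
          (((hdot fun k hk => (hτ k hk t ht).2.1).div_const b).const_mul αg)).div_const b,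
        (hp1 _ fun k hk => (hτ k hk t ht).2.2.2.2.1).trans hc1,
        (hp1 _ fun k hk => (hτ k hk t ht).2.2.2.2.2.1).trans hc1,
        (hp1 _ fun k hk => (hτ k hk t ht).2.2.2.2.2.2).trans hc1, ?_, ?_⟩
      · have := hp2 (fun k => τ₁ k t) fun k hk => (hτ k hk t ht).2.2.2.2.2.1
        rw [sub_div, sub_sub_cancel]
        exact this
      · rw [mul_div_cancel₀ _ hbn.ne]
        ring
    · have := hp2 (fun k => τ₀ k 0) fun k hk => (hτ k hk 0 hT0).2.2.2.2.1
      have e : ∀ k, (0 : GridFun) k = 0 := fun k => rfl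
      simp only [hσ0, e, zero_mul, Finset.sum_const_zero, zero_sub, neg_div, abs_neg]
      exact this
    · have := hp1 (fun k => τ₀ k 0) fun k hk => (hτ k hk 0 hT0).2.2.2.2.1
      calc h * |(∑ k ∈ Finset.range 4, τ₀ k 0 * α k) / b| ≤ h * (c * A * h / |b₀|) := by gcongr
        _ = (h ^ 2 * c) * (A / |b₀|) := by ring
        _ ≤ m * Q := by
          gcongr
          rw [hQ]
          have : 0 ≤ |αg| * A / |b₀| ^ 2 := by positivity
          linarith
  · have hg0 : 0 < |αg| := abs_pos.2 hαg
    set Q := 1 + A / |αg| with hQ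
    have hQ1 : 1 ≤ Q := by
      have : 0 ≤ A / |αg| := by positivity
      linarith
    refine ⟨K * Q, by positivity, ?_⟩
    intro h m x y σ τ₀ τ₁ τ₂ c h0 h1 hc hcm hx0 hy0 hσ0 hx hy hint hτ t ht
    have hm : 0 ≤ m := le_trans (by positivity) hcm
    have hT0 : (0 : ℝ) ∈ Icc 0 T := left_mem_Icc.2 (ht.1.trans ht.2)
    have hp : ∀ s : ℕ → ℝ, (∀ k < 4, |s k| ≤ c) →
        |(∑ k ∈ Finset.range 4, s k * α k) / αg| ≤ c * Q := fun s hs => by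
      rw [abs_div, div_le_iff₀ hg0]
      refine (abs_sum_mul_le hs).trans ?_
      rw [mul_assoc]
      gcongr
      rw [hQ, add_mul, div_mul_cancel₀ _ hg0.ne']
      linarith
    have hpd : ∀ t ∈ Icc 0 T, HasDerivWithinAt
        (fun t => (∑ k ∈ Finset.range 4, σ t k * α k) / αg)
        ((∑ k ∈ Finset.range 4, τ₀ k t * α k) / αg) (Icc 0 T) t := fun t ht =>
      (hdot (s := fun k τ => σ τ k) fun k hk => (hτ k hk t ht).1).div_const αg
    -- Integrating p makes p - a' vanish identically; the e₁ balance does not involve a, since b =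
    -- 0.
    obtain ⟨a, ha0, ha⟩ := exists_antiderivative (ht.1.trans ht.2)
      (fun t ht => (hpd t ht).continuousWithinAt)
    rw [mul_assoc, mul_comm Q]
    refine hK h (48 / 17 * 0 / h) (m * Q) x y σ τ₀ τ₁
      (fun t => (∑ k ∈ Finset.range 4, σ t k * α k) / αg)
      (fun t => (∑ k ∈ Finset.range 4, τ₀ k t * α k) / αg)
      (fun t => (∑ k ∈ Finset.range 4, τ₁ k t * α k) / αg) a
      (fun t => (∑ k ∈ Finset.range 4, σ t k * α k) / αg)
      (c * Q) h0 h1 (by simp) (by positivity) ?_ hx0 hy0 hσ0 hx hy ?_ ?_ ?_ ?_ ?_ t ht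
    · rw [← mul_assoc]
      gcongr
    · exact fun t ht => (hint t ht).trans (le_mul_of_one_le_right hm hQ1)
    · intro k hk t ht
      obtain ⟨d0, d1, -, c0, c1, c2, -⟩ := hτ k hk t ht
      have hcc : c ≤ c * Q := le_mul_of_one_le_right hc hQ1
      exact ⟨d0, d1, c0.trans hcc, c1.trans hcc, c2.trans hcc⟩
    · intro t ht
      refine ⟨hpd t ht, (hdot fun k hk => (hτ k hk t ht).2.1).div_const αg, ha t ht,
        hp _ fun k hk => (hτ k hk t ht).2.2.2.1, hp _ fun k hk => (hτ k hk t ht).2.2.2.2.1,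
        hp _ fun k hk => (hτ k hk t ht).2.2.2.2.2.1, ?_, ?_⟩
      · rw [sub_self, abs_zero]
        positivity
      · rw [div_mul_cancel₀ _ hαg]
        simp
    · rw [ha0, abs_zero]
      positivity
    · have e : ∀ k, (0 : GridFun) k = 0 := fun k => rfl
      simp only [hσ0, e, zero_mul, Finset.sum_const_zero, zero_div, abs_zero, mul_zero]
      positivity

/-! ### Sampled solutions and their truncation errors -/

lemma interiorPart_apply_of_lt (u : GridFun) {j : ℕ} (hj : j < 4) : interiorPart u j = 0 := by
  have e : interiorPart u j = u j - ∑ k ∈ Finset.range 4, u k * gridUnit k j := by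
    rw [interiorPart_apply]
    simp only [Finset.sum_range_succ, Finset.sum_range_zero]
    rfl
  rw [e]
  simp only [gridUnit_apply, mul_ite, mul_one, mul_zero]
  rw [Finset.sum_ite_eq, if_pos (Finset.mem_range.2 hj), sub_self]

lemma interiorPart_apply_add (u : GridFun) (j : ℕ) : interiorPart u (j + 4) = u (j + 4) := by
  have e : interiorPart u (j + 4)
      = u (j + 4) - ∑ k ∈ Finset.range 4, u k * gridUnit k (j + 4) := by
    rw [interiorPart_apply]
    simp only [Finset.sum_range_succ, Finset.sum_range_zero]
    rfl
  rw [e]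
  simp only [gridUnit_apply, mul_ite, mul_one, mul_zero]
  rw [Finset.sum_ite_eq, if_neg (by simp), sub_zero]

lemma norm_sq_le_of_sum_range_le {u : GridFun} {B : ℝ}
    (hB : ∀ J, ∑ j ∈ Finset.range J, u j ^ 2 ≤ B) : ‖u‖ ^ 2 ≤ B := by
  rw [gridFun_norm_sq]
  exact Real.tsum_le_of_sum_range_le (fun _ => sq_nonneg _) hB

lemma norm_interiorPart_sq_le {u : GridFun} {B : ℝ}
    (hB : ∀ J, ∑ j ∈ Finset.range J, u (j + 4) ^ 2 ≤ B) : ‖interiorPart u‖ ^ 2 ≤ B := by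
  refine norm_sq_le_of_sum_range_le fun J => le_trans ?_ (hB J)
  calc ∑ j ∈ Finset.range J, interiorPart u j ^ 2
      ≤ ∑ j ∈ Finset.range (J + 4), interiorPart u j ^ 2 :=
        Finset.sum_le_sum_of_subset_of_nonneg (Finset.range_mono (by omega))
          fun _ _ _ => sq_nonneg _
    _ = ∑ j ∈ Finset.range J, u (j + 4) ^ 2 := by
        rw [Finset.sum_range_succ', Finset.sum_range_succ', Finset.sum_range_succ',
          Finset.sum_range_succ']
        simp only [interiorPart_apply_of_lt u (show 0 < 4 by norm_num),
          interiorPart_apply_of_lt u (show 1 < 4 by norm_num), Nat.reduceAdd,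
          interiorPart_apply_of_lt u (show 2 < 4 by norm_num),
          interiorPart_apply_of_lt u (show 3 < 4 by norm_num), ne_eq, OfNat.ofNat_ne_zero,
          not_false_eq_true, zero_pow, add_zero, interiorPart_apply_add]

/-! ### Discrete norms of sampled profiles. -/

namespace Profile

variable {N : ℕ} {M : ℝ} {W : ℕ → ℝ → ℝ}

lemma norm_sample_le (hW : Profile N M W) (hM : 0 ≤ M) {k : ℕ} (hk : k + 1 ≤ N) {h : ℝ}
    (h0 : 0 < h) (h1 : h ≤ 1) {w : GridFun} (hw : ∀ j : ℕ, w j = W k (j * h)) :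
    ‖w‖ ≤ 2 * M / Real.sqrt h := by
  have hsp : 0 < Real.sqrt h := Real.sqrt_pos.2 h0
  rw [le_div_iff₀' hsp]
  refine le_of_sq_le_sq ?_ (by positivity)
  rw [mul_pow, Real.sq_sqrt h0.le, ← le_div_iff₀' h0]
  refine norm_sq_le_of_sum_range_le fun J => ?_
  rw [le_div_iff₀' h0, Finset.mul_sum]
  simp only [hw]
  linarith [hW.sum_sample_le hk h0 h1 J]

lemma sum_sub_add_four (f : ℕ → ℝ) (J : ℕ) :
    ∑ j ∈ Finset.range J, (f (j + 4) - f j)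
      = f J + f (J + 1) + f (J + 2) + f (J + 3) - (f 0 + f 1 + f 2 + f 3) := by
  induction J with
  | zero => simp
  | succ n ih =>
    rw [Finset.sum_range_succ, ih]
    ring_nf

/-- On each stencil the sup of the sixth derivative is bounded by the energy increment over 4h. The
weighted squares then telescope with overlap four, so an `L²` bound on seven derivatives suffices.
-/
lemma interior_truncation_norm (hW : Profile N M W) (hM : 0 ≤ M) (hN : 7 ≤ N) {h : ℝ}
    (h0 : 0 < h) (h1 : h ≤ 1) {w w₂ : GridFun} (hw : ∀ j : ℕ, w j = W 0 (j * h))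
    (hw₂ : ∀ j : ℕ, w₂ j = W 2 (j * h)) :
    Real.sqrt h * ‖interiorPart ((h ^ 2)⁻¹ • opD 1 w - w₂)‖ ≤ 1000 * M * h ^ 4 := by
  refine le_of_sq_le_sq ?_ (by positivity)
  rw [mul_pow, Real.sq_sqrt h0.le, ← le_div_iff₀' h0]
  refine norm_interiorPart_sq_le fun J => ?_
  rw [le_div_iff₀' h0, Finset.mul_sum]
  set E : ℕ → ℝ := fun j => energy W 6 ((j + 2 : ℕ) * h) with hE
  have hE0 : ∀ j, 0 ≤ E j := fun j => energy_nonneg (by positivity)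
  have hE2 : ∀ j, E j ≤ 2 * M ^ 2 := fun j => hW.energy_le (by omega) (by positivity)
  have hterm : ∀ j, h * ((h ^ 2)⁻¹ • opD 1 w - w₂) (j + 4) ^ 2
      ≤ 50000 * h ^ 8 * (E (j + 4) - E j) := by
    intro j
    set I := E (j + 4) - E j with hI
    have hpos : 0 ≤ ((j + 2 : ℕ) : ℝ) * h := by positivity
    have hI0 : 0 ≤ I := sub_nonneg.2 (hW.energy_mono 6 hpos (by gcongr; omega))
    -- The stencil has width 4h and 1 + 4h ≤ 5, hence 5/4.
    have hB : ∀ x ∈ Icc (((j + 2 : ℕ) : ℝ) * h) ((j + 6 : ℕ) * h),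
        |W 6 x| ≤ Real.sqrt (5 / 4 * I / h) := by
      intro x hx
      refine Real.abs_le_sqrt ?_
      rw [le_div_iff₀ h0]
      have e1 := hW.sq_le_energy 6 hpos hx
      rw [show ((j + 6 : ℕ) : ℝ) * h - (j + 2 : ℕ) * h = 4 * h by push_cast; ring] at e1
      change 4 * h * W 6 x ^ 2 ≤ (1 + 4 * h) * I at e1
      nlinarith
    have e2 := hW.interior_truncation h0 j hB
    have e3 : ((h ^ 2)⁻¹ • opD 1 w - w₂) (j + 4)
        = sbpD h (fun j => W 0 (j * h)) (j + 4) - W 2 ((j + 4 : ℕ) * h) := by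
      have hwf : (w : ℕ → ℝ) = fun j : ℕ => W 0 (j * h) := funext hw
      change (h ^ 2)⁻¹ * sbpD 1 w (j + 4) - w₂ (j + 4) = _
      rw [sbpD_eq_div h, hw₂, hwf, inv_mul_eq_div]
    rw [e3]
    have e4 := pow_le_pow_left₀ (abs_nonneg _) e2 2
    rw [sq_abs, mul_pow, mul_pow, Real.sq_sqrt (by positivity)] at e4
    calc _ ≤ h * (200 ^ 2 * (5 / 4 * I / h) * (h ^ 4) ^ 2) := by gcongr
      _ = 50000 * h ^ 8 * I := by
        field_simp
        ring
  refine (Finset.sum_le_sum fun j _ => hterm j).trans ?_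
  rw [← Finset.mul_sum, sum_sub_add_four]
  have : E J + E (J + 1) + E (J + 2) + E (J + 3) - (E 0 + E 1 + E 2 + E 3) ≤ 8 * M ^ 2 := by
    linarith [hE2 J, hE2 (J + 1), hE2 (J + 2), hE2 (J + 3), hE0 0, hE0 1, hE0 2, hE0 3]
  calc 50000 * h ^ 8 * _ ≤ 50000 * h ^ 8 * (8 * M ^ 2) := by gcongr
    _ ≤ (1000 * M * h ^ 4) ^ 2 := by
      nlinarith [mul_nonneg (sq_nonneg M) (sq_nonneg (h ^ 4))]

end Profile

/-- A square summable sequence as a grid function, and zero for other sequences. -/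
def toGrid (f : ℕ → ℝ) : GridFun :=
  open Classical in if hf : Memℓp f 2 then ⟨f, hf⟩ else 0

lemma toGrid_apply {f : ℕ → ℝ} (hf : Memℓp f 2) (j : ℕ) : toGrid f j = f j := by
  rw [toGrid, dif_pos hf]

/-- The `k`-th derivative in `x` of a function at time `t` on the grid. -/
def sample (h : ℝ) (F : ℝ → ℝ → ℝ) (k : ℕ) (t : ℝ) : GridFun :=
  toGrid fun j => xDeriv F t k (j * h)

/-! ### The sampled exact solution as a curve in `ℓ²`. -/

section Sampling

variable {T M h : ℝ} {f : ℝ → ℝ} {U V : ℝ → ℝ → ℝ}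

namespace IsSmoothWaveSolution

lemma profile_U (hsol : IsSmoothWaveSolution T f U V) (hT : 0 < T) (hM : 0 ≤ M)
    (hU : SobolevBound 7 T M U) {t : ℝ} (ht : t ∈ Icc 0 T) : Profile 7 M (xDeriv U t) :=
  profile_xDeriv hT hM hsol.smooth_U hU ht

lemma profile_V (hsol : IsSmoothWaveSolution T f U V) (hT : 0 < T) (hM : 0 ≤ M)
    (hV : SobolevBound 7 T M V) {t : ℝ} (ht : t ∈ Icc 0 T) : Profile 7 M (xDeriv V t) :=
  profile_xDeriv hT hM hsol.smooth_V hV ht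

lemma hasDerivWithinAt_U (hsol : IsSmoothWaveSolution T f U V) (hT : 0 < T) (k : ℕ) {x t : ℝ}
    (hx : 0 ≤ x) (ht : t ∈ Icc 0 T) :
    HasDerivWithinAt (fun τ => xDeriv U τ k x) (xDeriv V t k x) (Icc 0 T) t :=
  hasDerivWithinAt_xDeriv_time (m := 0) hT hsol.smooth_U hsol.smooth_V
    (fun x hx t ht => by rw [xDeriv_zero]; exact hsol.eq_U x hx t ht) k x hx t ht

lemma hasDerivWithinAt_V (hsol : IsSmoothWaveSolution T f U V) (hT : 0 < T) (k : ℕ) {x t : ℝ}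
    (hx : 0 ≤ x) (ht : t ∈ Icc 0 T) :
    HasDerivWithinAt (fun τ => xDeriv V τ k x) (xDeriv U t (k + 2) x) (Icc 0 T) t :=
  hasDerivWithinAt_xDeriv_time (m := 2) hT hsol.smooth_V hsol.smooth_U
    (fun x hx t ht => hsol.eq_V x hx t ht) k x hx t ht

lemma derivWithin_boundary (hsol : IsSmoothWaveSolution T f U V) (hT : 0 < T) {t : ℝ}
    (ht : t ∈ Icc 0 T) : derivWithin f (Icc 0 T) t = V 0 t := by
  rw [← derivWithin_congr hsol.dirichlet (hsol.dirichlet t ht)]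
  exact (hsol.eq_U 0 self_mem_Ici t ht).derivWithin (uniqueDiffOn_Icc hT t ht)

end IsSmoothWaveSolution

lemma Profile.sample_apply {N k : ℕ} {F : ℝ → ℝ → ℝ} {t : ℝ} (hF : Profile N M (xDeriv F t))
    (h0 : 0 < h) (h1 : h ≤ 1) (hk : k + 1 ≤ N) (j : ℕ) :
    sample h F k t j = xDeriv F t k (j * h) :=
  toGrid_apply (hF.memlp_sample hk h0 h1) j

namespace IsSmoothWaveSolution

lemma hasDerivWithinAt_sample_apply_U (hsol : IsSmoothWaveSolution T f U V) (hT : 0 < T)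
    (hM : 0 ≤ M) (hU : SobolevBound 7 T M U) (hV : SobolevBound 7 T M V) (h0 : 0 < h)
    (h1 : h ≤ 1) {k : ℕ} (hk : k ≤ 6) {t : ℝ} (ht : t ∈ Icc 0 T) (j : ℕ) :
    HasDerivWithinAt (fun τ => sample h U k τ j) (sample h V k t j) (Icc 0 T) t := by
  have e : ∀ τ ∈ Icc 0 T, sample h U k τ j = xDeriv U τ k (j * h) := fun τ hτ =>
    (hsol.profile_U hT hM hU hτ).sample_apply h0 h1 (by omega) j
  rw [(hsol.profile_V hT hM hV ht).sample_apply h0 h1 (by omega)]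
  exact (hsol.hasDerivWithinAt_U hT k (by positivity) ht).congr e (e t ht)

lemma hasDerivWithinAt_sample_apply_V (hsol : IsSmoothWaveSolution T f U V) (hT : 0 < T)
    (hM : 0 ≤ M) (hU : SobolevBound 7 T M U) (hV : SobolevBound 7 T M V) (h0 : 0 < h)
    (h1 : h ≤ 1) {k : ℕ} (hk : k ≤ 4) {t : ℝ} (ht : t ∈ Icc 0 T) (j : ℕ) :
    HasDerivWithinAt (fun τ => sample h V k τ j) (sample h U (k + 2) t j) (Icc 0 T) t := by
  have e : ∀ τ ∈ Icc 0 T, sample h V k τ j = xDeriv V τ k (j * h) := fun τ hτ =>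
    (hsol.profile_V hT hM hV hτ).sample_apply h0 h1 (by omega) j
  rw [(hsol.profile_U hT hM hU ht).sample_apply h0 h1 (by omega)]
  exact (hsol.hasDerivWithinAt_V hT k (by positivity) ht).congr e (e t ht)

lemma hasDerivWithinAt_sample_U (hsol : IsSmoothWaveSolution T f U V) (hT : 0 < T)
    (hM : 0 ≤ M) (hU : SobolevBound 7 T M U) (hV : SobolevBound 7 T M V) (h0 : 0 < h)
    (h1 : h ≤ 1) {t : ℝ} (ht : t ∈ Icc 0 T) :
    HasDerivWithinAt (sample h U 0) (sample h V 0 t) (Icc 0 T) t :=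
  grid_hasDerivWithinAt (R := sample h U 2)
    (fun _ ht j => hsol.hasDerivWithinAt_sample_apply_U hT hM hU hV h0 h1 (by norm_num) ht j)
    (fun _ ht j => hsol.hasDerivWithinAt_sample_apply_V hT hM hU hV h0 h1 (by norm_num) ht j)
    (fun _ ht => (hsol.profile_U hT hM hU ht).norm_sample_le hM (k := 2) (by norm_num) h0 h1
      ((hsol.profile_U hT hM hU ht).sample_apply h0 h1 (by norm_num))) ht

lemma hasDerivWithinAt_sample_V (hsol : IsSmoothWaveSolution T f U V) (hT : 0 < T)
    (hM : 0 ≤ M) (hU : SobolevBound 7 T M U) (hV : SobolevBound 7 T M V) (h0 : 0 < h)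
    (h1 : h ≤ 1) {t : ℝ} (ht : t ∈ Icc 0 T) :
    HasDerivWithinAt (sample h V 0) (sample h U 2 t) (Icc 0 T) t :=
  grid_hasDerivWithinAt (R := sample h V 2)
    (fun _ ht j => hsol.hasDerivWithinAt_sample_apply_V hT hM hU hV h0 h1 (by norm_num) ht j)
    (fun _ ht j => hsol.hasDerivWithinAt_sample_apply_U hT hM hU hV h0 h1 (by norm_num) ht j)
    (fun _ ht => (hsol.profile_V hT hM hV ht).norm_sample_le hM (k := 2) (by norm_num) h0 h1
      ((hsol.profile_V hT hM hV ht).sample_apply h0 h1 (by norm_num))) ht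

end IsSmoothWaveSolution

end Sampling

/-! ### The semidiscretization as an evolution equation -/

lemma boundaryTerm_apply (h β c : ℝ) (j : ℕ) :
    ((48 / 17 * β / h * c) • gridE1) j = β * (sbpH h j)⁻¹ * sbpE1 j * c := by
  change 48 / 17 * β / h * c * sbpE1 j = _
  rcases j with _ | j
  · simp only [sbpH, sbpE1, mul_inv]
    ring
  · simp [sbpE1]

/-- A and d₁ both scale like 1/h, so the same g serves every h, and injectivity of A turns the
implicit equation into an explicit one. -/
lemma scheme_u_iff {h : ℝ} (h0 : 0 < h) (ut v : GridFun) (c : ℝ) :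
    (∀ j, sbpA h (fun i => ut i - v i) j = sbpD1 h j * c) ↔ ut = v + c • gridG := by
  have key : (∀ j, sbpA h (fun i => ut i - v i) j = sbpD1 h j * c)
      ↔ opA 1 (ut - v) = opA 1 (c • gridG) := by
    rw [map_smul, opA_gridG]
    constructor
    · intro H
      apply lp.ext
      funext j
      have := H j
      rw [sbpA_eq_div, sbpD1_eq_div] at this
      change sbpA 1 (fun i => ut i - v i) j = c * sbpD1 1 j
      field_simp at this
      linarith
    · intro H j
      have : sbpA 1 (fun i => ut i - v i) j = c * sbpD1 1 j :=
        congrFun (congrArg (fun w : GridFun => (w : ℕ → ℝ)) H) j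
      rw [sbpA_eq_div, sbpD1_eq_div, this]
      ring
  rw [key, opA_injective.eq_iff, sub_eq_iff_eq_add']

lemma scheme_v_iff (h β : ℝ) (vt u : GridFun) (c : ℝ) :
    (∀ j, vt j = sbpD h (fun i => u i) j + β * (sbpH h j)⁻¹ * sbpE1 j * c) ↔
      vt = (h ^ 2)⁻¹ • opD 1 u + (48 / 17 * β / h * c) • gridE1 := by
  have e : ∀ j, ((h ^ 2)⁻¹ • opD 1 u + (48 / 17 * β / h * c) • gridE1) j
      = sbpD h (fun i => u i) j + β * (sbpH h j)⁻¹ * sbpE1 j * c := fun j => by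
    change (h ^ 2)⁻¹ * sbpD 1 u j + ((48 / 17 * β / h * c) • gridE1) j = _
    rw [boundaryTerm_apply, sbpD_eq_div h, inv_mul_eq_div]
  constructor
  · intro H
    apply lp.ext
    funext j
    rw [H j, e j]
  · rintro rfl j
    exact e j

lemma exists_schemeSolution {T M h : ℝ} {f : ℝ → ℝ} {U V : ℝ → ℝ → ℝ}
    (hsol : IsSmoothWaveSolution T f U V) (hT : 0 < T) (hM : 0 ≤ M)
    (hU : SobolevBound 7 T M U) (hV : SobolevBound 7 T M V) (h0 : 0 < h) (h1 : h ≤ 1) (β : ℝ) :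
    ∃ u v : ℝ → GridFun, IsSchemeSolution h β T f U V u v := by
  have hT0 : (0 : ℝ) ∈ Icc 0 T := left_mem_Icc.2 hT.le
  have hVc : ContinuousOn (fun t => V 0 t) (Icc 0 T) := fun t ht =>
    (hsol.eq_V 0 self_mem_Ici t ht).continuousWithinAt
  -- The boundary datum f_t = V(0, ·) is extended continuously to all times, as the global evolution
  -- equation requires.
  set q : ℝ → ℝ := IccExtend hT.le ((Icc 0 T).domRestrict fun t => V 0 t) with hq
  have hqc : Continuous q := (continuousOn_iff_continuous_domRestrict.1 hVc).Icc_extend'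
  have hqV : ∀ t ∈ Icc 0 T, q t = V 0 t := fun t ht => IccExtend_of_mem hT.le _ ht
  let fstL := ContinuousLinearMap.fst ℝ GridFun GridFun
  let sndL := ContinuousLinearMap.snd ℝ GridFun GridFun
  let v₀ := (lp.evalCLM ℝ (fun _ : ℕ => ℝ) 2 0).comp sndL
  obtain ⟨y, hy0, hy⟩ := exists_linear_evolution
    ((sndL + v₀.smulRight gridG).prod
      ((h ^ 2)⁻¹ • (opD 1).comp fstL + (48 / 17 * β / h) • v₀.smulRight gridE1))
    (F := fun t => (-q t • gridG, -(48 / 17 * β / h * q t) • gridE1)) (by fun_prop)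
    (sample h U 0 0, sample h V 0 0)
  refine ⟨fun t => (y t).1, fun t => (y t).2, fun j => ?_, fun j => ?_, fun t ht => ?_⟩
  · simp only [hy0]
    rw [(hsol.profile_U hT hM hU hT0).sample_apply h0 h1 (by norm_num), xDeriv_zero]
  · simp only [hy0]
    rw [(hsol.profile_V hT hM hV hT0).sample_apply h0 h1 (by norm_num), xDeriv_zero]
  · have d1 := (fstL.hasFDerivAt.comp_hasDerivAt t (hy t)).hasDerivWithinAt (s := Icc 0 T)
    have d2 := (sndL.hasFDerivAt.comp_hasDerivAt t (hy t)).hasDerivWithinAt (s := Icc 0 T)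
    refine ⟨_, _, d1, d2, ?_, ?_⟩
    · rw [scheme_u_iff h0, hsol.derivWithin_boundary hT ht, ← hqV t ht]
      change (y t).2 + (y t).2 0 • gridG + -q t • gridG = _
      module
    · rw [scheme_v_iff, hsol.derivWithin_boundary hT ht, ← hqV t ht]
      change (h ^ 2)⁻¹ • opD 1 (y t).1 + (48 / 17 * β / h) • (y t).2 0 • gridE1
        + -(48 / 17 * β / h * q t) • gridE1 = _
      module

/-! ### Convergence -/

lemma Profile.boundary_truncation_grid {N : ℕ} {M h : ℝ} {W : ℕ → ℝ → ℝ} (hW : Profile N M W)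
    (hM : 0 ≤ M) (hN : 5 ≤ N) (h0 : 0 < h) {w w₂ : GridFun} (hw : ∀ j : ℕ, w j = W 0 (j * h))
    (hw₂ : ∀ j : ℕ, w₂ j = W 2 (j * h)) {k : ℕ} (hk : k < 4) :
    |((h ^ 2)⁻¹ • opD 1 w - w₂) k| ≤ 16000 * M * h ^ 2 := by
  have hwf : (w : ℕ → ℝ) = fun j : ℕ => W 0 (j * h) := funext hw
  have e : ((h ^ 2)⁻¹ • opD 1 w - w₂) k = sbpD h (fun j => W 0 (j * h)) k - W 2 (k * h) := by
    change (h ^ 2)⁻¹ * sbpD 1 w k - w₂ k = _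
    rw [sbpD_eq_div h, hw₂, hwf, inv_mul_eq_div]
  rw [e]
  exact hW.boundary_truncation hM hN h0 hk

lemma eq_of_hasDerivWithinAt_eq {E : Type*} [NormedAddCommGroup E] [NormedSpace ℝ E] {T : ℝ}
    {f g f' : ℝ → E} (hf : ∀ t ∈ Icc 0 T, HasDerivWithinAt f (f' t) (Icc 0 T) t)
    (hg : ∀ t ∈ Icc 0 T, HasDerivWithinAt g (f' t) (Icc 0 T) t) (h0 : f 0 = g 0) {t : ℝ}
    (ht : t ∈ Icc 0 T) : f t = g t := by
  have := norm_sub_le_of_hasDerivWithinAt (f := fun t => f t - g t) (f' := fun _ => 0) (C := 0)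
    (fun t ht => by simpa using! (hf t ht).sub (hg t ht)) (by simp) ht
  rw [h0, sub_self, sub_zero, zero_mul] at this
  exact sub_eq_zero.1 (norm_le_zero_iff.1 this)

set_option maxHeartbeats 1000000 in
/-- For nonpositive dissipation parameter the scheme converges with rate four. -/
lemma convergesWithRate_four {β : ℝ} (hβ : β ≤ 0) : ConvergesWithRate β 4 := by
  refine ⟨7, fun T hT => ?_⟩
  obtain ⟨K, hK0, hK⟩ := exists_forcing_estimate hβ T
  -- 16000 is the constant of the boundary truncation error; 1 + T covers both σ, integrated over
  -- [0, T], and its derivatives.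
  refine ⟨K * (16000 * (1 + T)), fun M hM f U V hsol hU hV h h0 h1 =>
    ⟨exists_schemeSolution hsol hT hM hU hV h0 h1 β, fun u v hs t ht => ?_⟩⟩
  have hT0 : (0 : ℝ) ∈ Icc 0 T := left_mem_Icc.2 hT.le
  have hsp : 0 < Real.sqrt h := Real.sqrt_pos.2 h0
  have hUp := fun {t : ℝ} (ht : t ∈ Icc 0 T) => hsol.profile_U hT hM hU ht
  have hVp := fun {t : ℝ} (ht : t ∈ Icc 0 T) => hsol.profile_V hT hM hV ht
  have hUs := fun {t : ℝ} (ht : t ∈ Icc 0 T) => hsol.hasDerivWithinAt_sample_U hT hM hU hV h0 h1 ht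
  have hVs := fun {t : ℝ} (ht : t ∈ Icc 0 T) => hsol.hasDerivWithinAt_sample_V hT hM hU hV h0 h1 ht
  set e : ℝ → GridFun := fun t => u t - sample h U 0 t with he
  set ε : ℝ → GridFun := fun t => v t - sample h V 0 t with hε
  have hb : ∀ t ∈ Icc 0 T, v t 0 - derivWithin f (Icc 0 T) t = ε t 0 := fun t ht => by
    change _ = v t 0 - sample h V 0 t 0
    rw [hsol.derivWithin_boundary hT ht, (hVp ht).sample_apply h0 h1 (by norm_num), xDeriv_zero,
      Nat.cast_zero, zero_mul]
  have hed : ∀ t ∈ Icc 0 T, HasDerivWithinAt e (ε t + ε t 0 • gridG) (Icc 0 T) t := by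
    intro t ht
    obtain ⟨ut, vt, du, -, eu, -⟩ := hs.evolution t ht
    rw [hb t ht, scheme_u_iff h0] at eu
    refine (du.sub (hUs ht)).congr_deriv ?_
    rw [eu]
    simp only [hε]
    abel
  have hεd : ∀ t ∈ Icc 0 T, HasDerivWithinAt ε ((h ^ 2)⁻¹ • opD 1 (u t)
      + (48 / 17 * β / h * ε t 0) • gridE1 - sample h U 2 t) (Icc 0 T) t := by
    intro t ht
    obtain ⟨ut, vt, -, dv, -, ev⟩ := hs.evolution t ht
    rw [hb t ht, scheme_v_iff] at ev
    refine (dv.sub (hVs ht)).congr_deriv ?_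
    rw [ev]
  have he0 : e 0 = 0 := by
    apply lp.ext
    funext j
    change u 0 j - sample h U 0 0 j = 0
    rw [hs.init_u, (hUp hT0).sample_apply h0 h1 (by norm_num), xDeriv_zero, sub_self]
  have hε0 : ε 0 = 0 := by
    apply lp.ext
    funext j
    change v 0 j - sample h V 0 0 j = 0
    rw [hs.init_v, (hVp hT0).sample_apply h0 h1 (by norm_num), xDeriv_zero, sub_self]
  obtain ⟨x, hx0, hx⟩ := exists_antiderivative hT.le fun t ht => (hed t ht).continuousWithinAt
  obtain ⟨y, hy0, hy⟩ := exists_antiderivative hT.le fun t ht => (hεd t ht).continuousWithinAt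
  obtain ⟨S, hS0, hS⟩ := exists_antiderivative hT.le fun t ht => (hUs ht).continuousWithinAt
  -- The time integral of the truncation error in closed form, using V_t = U_xx.
  set σ : ℝ → GridFun := fun t => (h ^ 2)⁻¹ • opD 1 (S t) - (sample h V 0 t - sample h V 0 0)
    with hσ
  have hσ0 : σ 0 = 0 := by simp [hσ, hS0]
  have hD : ∀ {P : ℝ → GridFun} {P' : GridFun} {t : ℝ}, HasDerivWithinAt P P' (Icc 0 T) t →
      HasDerivWithinAt (fun t => (h ^ 2)⁻¹ • opD 1 (P t)) ((h ^ 2)⁻¹ • opD 1 P') (Icc 0 T) t :=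
    fun hP => ((opD 1).hasFDerivAt.comp_hasDerivWithinAt _ hP).const_smul ((h ^ 2)⁻¹)
  have hσd : ∀ t ∈ Icc 0 T, HasDerivWithinAt σ
      ((h ^ 2)⁻¹ • opD 1 (sample h U 0 t) - sample h U 2 t) (Icc 0 T) t := fun t ht =>
    (hD (hS t ht)).sub ((hVs ht).sub_const _)
  -- The error equations integrated once in time; both sides agree at time zero.
  have hxe : ∀ t ∈ Icc 0 T, e t = y t + y t 0 • gridG := fun t ht =>
    eq_of_hasDerivWithinAt_eq hed
      (fun t ht => (hy t ht).add ((hasDerivWithinAt_apply (hy t ht) 0).smul_const gridG))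
      (by
        have : y 0 0 = 0 := by rw [hy0]; rfl
        change e 0 = y 0 + y 0 0 • gridG
        rw [he0, this, hy0, zero_smul, add_zero]) ht
  have hyε : ∀ t ∈ Icc 0 T, ε t = (h ^ 2)⁻¹ • opD 1 (x t)
      + (48 / 17 * β / h * y t 0) • gridE1 + σ t := fun t ht =>
    eq_of_hasDerivWithinAt_eq hεd
      (fun t ht => (((hD (hx t ht)).add (((hasDerivWithinAt_apply (hy t ht) 0).const_mul
        (48 / 17 * β / h)).smul_const gridE1)).add (hσd t ht)).congr_deriv (by
          simp only [he, map_sub]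
          module))
      (by
        have : y 0 0 = 0 := by rw [hy0]; rfl
        change ε 0 = (h ^ 2)⁻¹ • opD 1 (x 0) + (48 / 17 * β / h * y 0 0) • gridE1 + σ 0
        rw [hε0, hx0, this, hσ0, mul_zero, zero_smul, map_zero, smul_zero, add_zero, add_zero]) ht
  set c := 16000 * (1 + T) * M * h ^ 2 with hc
  have hcle : 16000 * M * h ^ 2 ≤ c := by
    have : 0 ≤ 16000 * T * M * h ^ 2 := by positivity
    rw [hc]
    linarith
  have hτ₀ : ∀ k < 4, ∀ t ∈ Icc 0 T,
      |((h ^ 2)⁻¹ • opD 1 (sample h U 0 t) - sample h U 2 t) k| ≤ 16000 * M * h ^ 2 :=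
    fun k hk t ht => (hUp ht).boundary_truncation_grid hM (by norm_num) h0
      ((hUp ht).sample_apply h0 h1 (by norm_num)) ((hUp ht).sample_apply h0 h1 (by norm_num)) hk
  have hτ₁ : ∀ k < 4, ∀ t ∈ Icc 0 T,
      |((h ^ 2)⁻¹ • opD 1 (sample h V 0 t) - sample h V 2 t) k| ≤ 16000 * M * h ^ 2 :=
    fun k hk t ht => (hVp ht).boundary_truncation_grid hM (by norm_num) h0
      ((hVp ht).sample_apply h0 h1 (by norm_num)) ((hVp ht).sample_apply h0 h1 (by norm_num)) hk
  -- The third derivative of σ is the truncation error of U_xx. It takes five further derivatives,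
  -- which together with the interior estimate accounts for the seven assumed.
  have hτ₂ : ∀ k < 4, ∀ t ∈ Icc 0 T,
      |((h ^ 2)⁻¹ • opD 1 (sample h U 2 t) - sample h U 4 t) k| ≤ 16000 * M * h ^ 2 :=
    fun k hk t ht => ((hUp ht).shift (m := 2) (n := 5) (by norm_num)).boundary_truncation_grid hM
      (by norm_num) h0 ((hUp ht).sample_apply h0 h1 (by norm_num))
      ((hUp ht).sample_apply h0 h1 (by norm_num)) hk
  have hint : ∀ t ∈ Icc 0 T, Real.sqrt h * ‖interiorPart (σ t)‖ ≤ h ^ 2 * c := by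
    intro t ht
    have e1 := norm_sub_le_of_hasDerivWithinAt (f := fun t => interiorPart (σ t))
      (C := 1000 * M * h ^ 4 / Real.sqrt h)
      (fun t ht => interiorPart.hasFDerivAt.comp_hasDerivWithinAt t (hσd t ht))
      (fun t ht => by
        rw [le_div_iff₀' hsp]
        exact (hUp ht).interior_truncation_norm hM (by norm_num) h0 h1
          ((hUp ht).sample_apply h0 h1 (by norm_num)) ((hUp ht).sample_apply h0 h1 (by norm_num)))
      ht
    simp only [hσ0, map_zero, sub_zero] at e1
    calc Real.sqrt h * ‖interiorPart (σ t)‖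
        ≤ Real.sqrt h * (1000 * M * h ^ 4 / Real.sqrt h * T) := by gcongr
      _ = 1000 * (T * (M * h ^ 4)) := by field_simp
      _ ≤ h ^ 2 * c := by
        have e2 : 0 ≤ T * (M * h ^ 4) := by positivity
        have e3 : 0 ≤ M * h ^ 4 := by positivity
        rw [hc]
        linarith
  have key := hK h (h ^ 2 * c) x y σ
    (fun k t => ((h ^ 2)⁻¹ • opD 1 (sample h U 0 t) - sample h U 2 t) k)
    (fun k t => ((h ^ 2)⁻¹ • opD 1 (sample h V 0 t) - sample h V 2 t) k)
    (fun k t => ((h ^ 2)⁻¹ • opD 1 (sample h U 2 t) - sample h U 4 t) k)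
    c h0 h1 (by positivity) le_rfl hx0 hy0 hσ0
    (fun t ht => (hxe t ht) ▸ hx t ht) (fun t ht => (hyε t ht) ▸ hy t ht) hint
    (fun k hk t ht => ⟨hasDerivWithinAt_apply (hσd t ht) k,
      (hasDerivWithinAt_apply (hD (hUs ht)) k).sub
        (hsol.hasDerivWithinAt_sample_apply_U hT hM hU hV h0 h1 (by norm_num) ht k),
      (hasDerivWithinAt_apply (hD (hVs ht)) k).sub
        (hsol.hasDerivWithinAt_sample_apply_V hT hM hU hV h0 h1 (by norm_num) ht k),
      by
        have e1 := norm_sub_le_of_hasDerivWithinAt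
          (fun t ht => hasDerivWithinAt_apply (hσd t ht) k) (hτ₀ k hk) ht
        have e2 : σ 0 k = 0 := by rw [hσ0]; rfl
        rw [e2, sub_zero, Real.norm_eq_abs] at e1
        refine e1.trans ?_
        have : 0 ≤ 16000 * M * h ^ 2 := by positivity
        rw [hc]
        linarith,
      (hτ₀ k hk t ht).trans hcle, (hτ₁ k hk t ht).trans hcle, (hτ₂ k hk t ht).trans hcle⟩) t ht
  rw [← hxe t ht] at key
  have hcoord : (fun j : ℕ => (u t j - U (j * h) t) ^ 2) = fun j => e t j ^ 2 := by
    funext j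
    change _ = (u t j - sample h U 0 t j) ^ 2
    rw [(hUp ht).sample_apply h0 h1 (by norm_num), xDeriv_zero]
  rw [hcoord]
  refine ⟨gridFun_summable_sq _, ?_⟩
  rw [← gridFun_norm_sq, Real.sqrt_mul h0.le, Real.sqrt_sq (norm_nonneg _)]
  refine key.trans_eq ?_
  rw [hc]
  ring

lemma ConvergesWithRate.mono {β : ℝ} {r s : ℕ} (hr : ConvergesWithRate β r) (hsr : s ≤ r) :
    ConvergesWithRate β s := by
  obtain ⟨N, hN⟩ := hr
  refine ⟨N, fun T hT => ?_⟩
  obtain ⟨K, hK⟩ := hN T hT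
  refine ⟨|K|, fun M hM f U V hsol hU hV h h0 h1 => ?_⟩
  obtain ⟨hex, herr⟩ := hK M hM f U V hsol hU hV h h0 h1
  refine ⟨hex, fun u v hs t ht => ⟨(herr u v hs t ht).1, (herr u v hs t ht).2.trans ?_⟩⟩
  exact mul_le_mul_of_nonneg_right (mul_le_mul (le_abs_self K)
    (pow_le_pow_of_le_one h0.le h1 hsr) (by positivity) (abs_nonneg K)) hM

end

theorem theorem2 :
    (∀ β : ℝ, β < 0 → ConvergesWithRate β 4) ∧ ConvergesWithRate 0 3 :=
  -- The conserving case also has rate four here and is weakened to three.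
  ⟨fun _ hβ => convergesWithRate_four hβ.le,
    (convergesWithRate_four le_rfl).mono (by norm_num)⟩
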